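/- Let $q$ be a prime power and let $1\le d\le q+1$ be an integer; assume that $q$ is odd, or that $q$ is even and $d$ is odd. Then there exists a quantum MDS code $[\![q^2+1,\,q^2+3-2d,\,d]\!]_q$, that is, a subspace of $(\mathbb{C}^q)^{\otimes (q^2+1)}$ of dimension $q^{\,q^2+3-2d}$ whose minimum distance is exactly $d$ (every error acting on fewer than $d$ of the qudits is detectable, and some error acting on at most $d$ qudits is not), so that the quantum Singleton bound $k+2d\le n+2$ holds with equality. Moreover, such a code is obtained as follows. Put $n=q^2+1$. For a linear code $C\subseteq\mathbb{F}_{q^2}^n$ let $C^*=\{v\in\mathbb{F}_{q^2}^n : \sum_i c_i^q v_i=0 \text{ for all } c\in C\}$ be its Hermitian dual and let $P(C)=\langle (c_i^q c_i')_{i=1}^n : c,c'\in C\rangle_{\mathbb{F}_{q^2}}^{\perp}\cap\mathbb{F}_q^n$ be its puncture code. There are a linear code $C\subseteq\mathbb{F}_{q^2}^n$ such that $C^*$ is a cyclic or constacyclic MDS code with parameters $[q^2+1,\,q^2+2-d,\,d]_{q^2}$, a word $x\in P(C)$ of Hamming weight $q^2+1$, and $y\in\mathbb{F}_{q^2}^n$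 with $y_i^{q+1}=x_i$ for all $i$, such that the code $D=\{(y_ic_i)_{i=1}^n : c\in C\}$ is contained in $D^*$ and a stabilizer code belonging to $D$ is a quantum MDS code $[\![q^2+1,q^2+3-2d,d]\!]_q$. Here, for a fixed nontrivial additive character $\chi$ of $\mathbb{F}_q$ and a fixed $\mathbb{F}_q$-basis of $\mathbb{F}_{q^2}$ (both arbitrary), a stabilizer code belonging to $D$ is a nonzero joint eigenspace of the operators $X(a)Z(b)$, where $X(a)|z\rangle=|z+a\rangle$, $Z(b)|z\rangle=\chi(\sum_i b_iz_i)|z\rangle$ for $z\in\mathbb{F}_q^n$, and $(a_i,b_i)$ are the coordinates of $c_i$ in that basis, for $c\in D$. -/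

import Mathlib

/-! ### Classical linear codes -/

section Classical

variable {ι : Type*} [Fintype ι] {K F : Type*} [Field K] [Field F] [Algebra K F]

/-- `C` is a linear code `[n, k, d]` (with `n` the number of coordinates): it has dimension `k`
and the least Hamming weight of a nonzero codeword is exactly `d`. -/
def IsLinearCode [DecidableEq F] (C : Submodule F (ι → F)) (k d : ℕ) : Prop :=
  Module.finrank F C = k ∧ IsLeast {w : ℕ | ∃ c ∈ C, c ≠ 0 ∧ hammingNorm c = w} d

/-- `C` is an MDS code `[n, k, d]`, that is, a linear code with `k + d = n + 1`. -/
def IsMDSCode [DecidableEq F] (C : Submodule F (ι → F)) (k d : ℕ) : Prop :=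
  IsLinearCode C k d ∧ k + d = Fintype.card ι + 1

/-- The constacyclic shift `(c₀, …, cₙ₋₁) ↦ (γ cₙ₋₁, c₀, …, cₙ₋₂)`.
(Subtraction in `Fin n` is modulo `n`, so `0 - 1` is the last index.) -/
def constaShift {n : ℕ} [NeZero n] (γ : F) (c : Fin n → F) : Fin n → F :=
  fun i => if i = 0 then γ * c (i - 1) else c (i - 1)

/-- `C` is constacyclic for some nonzero shift constant `γ`; it is cyclic when `γ = 1`. -/
def IsConstacyclic {n : ℕ} [NeZero n] (C : Submodule F (Fin n → F)) : Prop :=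
  ∃ γ : F, γ ≠ 0 ∧ ∀ c ∈ C, constaShift γ c ∈ C

/-- The Hermitian dual `{v | ∀ c ∈ C, ∑ cᵢ^q vᵢ = 0}` of a code over the field with `q²`
elements. -/
def hermitianDual (q : ℕ) (C : Submodule F (ι → F)) : Submodule F (ι → F) where
  carrier := {v | ∀ c ∈ C, ∑ i, c i ^ q * v i = 0}
  zero_mem' := by intro c _; simp
  add_mem' := by
    intro v w hv hw c hc
    simp only [Pi.add_apply, mul_add, Finset.sum_add_distrib, hv c hc, hw c hc, add_zero]
  smul_mem' := by
    intro a v hv c hc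
    have h : ∀ i, c i ^ q * (a • v) i = a * (c i ^ q * v i) := by
      intro i; simp only [Pi.smul_apply, smul_eq_mul]; ring
    simp only [h, ← Finset.mul_sum, hv c hc, mul_zero]

/-- The puncture code `⟨(cᵢ^q c'ᵢ)ᵢ : c, c' ∈ C⟩^⊥ ∩ Kⁿ`, where the span is over `F`, the dual is
with respect to the standard bilinear form, and `K` is the subfield with `q` elements. -/
def punctureCode (K : Type*) [Field K] [Algebra K F] (q : ℕ) (C : Submodule F (ι → F)) :
    Submodule K (ι → K) where
  carrier := {x | ∀ s ∈ Submodule.span F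
      {s : ι → F | ∃ c ∈ C, ∃ c' ∈ C, s = fun i => c i ^ q * c' i},
    ∑ i, s i * algebraMap K F (x i) = 0}
  zero_mem' := by intro s _; simp
  add_mem' := by
    intro x y hx hy s hs
    simp only [Pi.add_apply, map_add, mul_add, Finset.sum_add_distrib, hx s hs, hy s hs, add_zero]
  smul_mem' := by
    intro a x hx s hs
    have h : ∀ i, s i * algebraMap K F ((a • x) i)
        = algebraMap K F a * (s i * algebraMap K F (x i)) := by
      intro i; simp only [Pi.smul_apply, smul_eq_mul, map_mul]; ring
    simp only [h, ← Finset.mul_sum, hx s hs, mul_zero]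

/-- The code `{(yᵢ cᵢ)ᵢ : c ∈ C}`. -/
def rescale (y : ι → F) (C : Submodule F (ι → F)) : Submodule F (ι → F) :=
  C.map (LinearMap.pi fun i => y i • LinearMap.proj i)

end Classical

/-! ### Quantum codes

The state space of the qudits indexed by `ι`, each with orthonormal basis `|a⟩`, `a ∈ A`, is
`(ℂ^A)^{⊗ι}`; its product basis is indexed by `ι → A`, so it is the space `(ι → A) → ℂ` with the
Hermitian form `⟨u, v⟩ = ∑ₓ conj (u x) * v x = star u ⬝ᵥ v`. -/

section Quantum

variable {ι : Type*} [Fintype ι] [DecidableEq ι] {A : Type*} [Fintype A]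

/-- The operator `E` acts only on the qudits in `S`: it is `M ⊗ 1` for an operator `M` on the
qudits in `S`. -/
def ActsOn (S : Finset ι) (E : Matrix (ι → A) (ι → A) ℂ) : Prop :=
  ∃ M : Matrix (S → A) (S → A) ℂ, ∀ x y : ι → A,
    ((∀ i, i ∉ S → x i = y i) → E x y = M (fun i => x i) (fun i => y i)) ∧
    (¬ (∀ i, i ∉ S → x i = y i) → E x y = 0)

/-- The code `Q` detects every error on fewer than `d` qudits (Knill–Laflamme condition
`P E P = c_E P`, with `P` the projection onto `Q`). -/
def HasDistanceAtLeast (Q : Submodule ℂ ((ι → A) → ℂ)) (d : ℕ) : Prop :=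
  ∀ S : Finset ι, S.card < d → ∀ E : Matrix (ι → A) (ι → A) ℂ, ActsOn S E →
    ∃ c : ℂ, ∀ u ∈ Q, ∀ v ∈ Q, star u ⬝ᵥ E.mulVec v = c * (star u ⬝ᵥ v)

/-- `Q` is a quantum code `[[n, k, d]]_q` with `n` the number of qudits, `q` the size of `A`:
its dimension is `q ^ k` and its minimum distance is exactly `d`.  (Meant for `k ≥ 1`; for
one-dimensional codes the minimum distance is defined by a separate convention.) -/
def IsQuantumCode (Q : Submodule ℂ ((ι → A) → ℂ)) (k d : ℕ) : Prop :=
  Module.finrank ℂ Q = Fintype.card A ^ k ∧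
    HasDistanceAtLeast Q d ∧ ¬ HasDistanceAtLeast Q (d + 1)

/-- `Q` is a quantum MDS code `[[n, k, d]]_q`: equality holds in the quantum Singleton bound
`k + 2 d ≤ n + 2`. -/
def IsQuantumMDSCode (Q : Submodule ℂ ((ι → A) → ℂ)) (k d : ℕ) : Prop :=
  IsQuantumCode Q k d ∧ k + 2 * d = Fintype.card ι + 2

end Quantum

/-! ### Stabilizer codes -/

section Stabilizer

variable {ι : Type*} [Fintype ι] {K F : Type*} [Field K] [Field F] [Algebra K F]

/-- The generalized Pauli operator `X(a) Z(b)`, where `X(a)|x⟩ = |x + a⟩` and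
`Z(b)|x⟩ = χ(b · x)|x⟩` for an additive character `χ` of `K`. -/
def pauli (χ : AddChar K ℂ) (a b : ι → K) (v : (ι → K) → ℂ) : (ι → K) → ℂ :=
  fun x => χ (b ⬝ᵥ (x - a)) * v (x - a)

/-- `Q` is a stabilizer code belonging to the classical code `D` over the quadratic extension `F`
of `K`: codewords `c ∈ D` are read as Pauli operators `X(a) Z(b)` by `(aᵢ, bᵢ) = e (cᵢ)`, where `e`
gives the coordinates in a `K`-basis of `F`, and `Q` is a nonzero joint eigenspace of all of them.
Here `θ c` is the eigenvalue of the operator belonging to `c`; equivalently, `Q` is the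
fixed space of the operators `(θ c)⁻¹ X(a) Z(b)`. -/
def IsStabilizerCodeOf (χ : AddChar K ℂ) (e : F ≃ₗ[K] K × K) (D : Submodule F (ι → F))
    (Q : Submodule ℂ ((ι → K) → ℂ)) : Prop :=
  Q ≠ ⊥ ∧ ∃ θ : (ι → F) → ℂ, ∀ v : (ι → K) → ℂ,
    v ∈ Q ↔ ∀ c ∈ D, pauli χ (fun i => (e (c i)).1) (fun i => (e (c i)).2) v = θ c • v

end Stabilizer

/-! Let `K` have `q` elements, let `F` and `E` be its extensions of degrees `2` and `4`, and let
`η` generate `Eˣ`. The powers `η ^ i`, `i ≤ q²`, represent the points of the projective line of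
the plane `E` over `F`, each of them once. Let `C` be the code of the values at these points of
the `F`-forms of degree `m = d - 2` on `E`. A nonzero form has at most `m` zeros on the line, so
`C` and its Hermitian dual are MDS; multiplication by `η` moves the points cyclically up to the
scalar `η ^ (q² + 1) ∈ F`, so the dual is constacyclic.

Since a form of degree `q² - 1` has sum `0` over the points, a `K`-valued form `v` of degree `s`
gives a word of the puncture code when `m q + m + s = q² - 1`. The pairing of `C` with itself is
Hermitian, so `v` may be replaced by its trace even when it is not `K`-valued. For `m = q - 1` the
constant word `1` will do. For `m = q - 2` and `q` odd, the form
`Tr(X ^ (q + 1) + X ^ 2 * Y ^ (q - 1)) - c * N(Y)` equals `N(Y) * (Tr(X / Y) ^ 2 - c)` where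
`Y ≠ 0`, so it has no zero if `c` is a nonsquare. Multiplication by powers of `N_{E/K}`, which never
vanishes on the points, lowers `m` by `2` at a time and reaches all the remaining degrees.

A word without zero entries in the puncture code rescales `C` to a Hermitian self-orthogonal code
`D`. Reading words of `D` as Pauli operators turns the Hermitian form into the symplectic form that
governs commutation, so these operators commute and have a joint eigenvector. The traces of the
Pauli operators give the dimension `q ^ n / |D|` of the joint eigenspace, and it detects exactly
the Pauli errors outside `D^*` or inside `D`. -/

section PauliOperators

variable {ι : Type*} [Fintype ι] {K : Type*} [Field K] {χ : AddChar K ℂ}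

/-- The operator `X(a) Z(b)` as an endomorphism, with the two labels collected in the word
`i ↦ (aᵢ, bᵢ)`. -/
def pauliEnd (χ : AddChar K ℂ) (w : ι → K × K) : Module.End ℂ ((ι → K) → ℂ) where
  toFun := pauli χ (fun i => (w i).1) fun i => (w i).2
  map_add' u v := by funext x; simp only [pauli, Pi.add_apply, mul_add]
  map_smul' r v := by
    funext x; simp only [pauli, Pi.smul_apply, smul_eq_mul, RingHom.id_apply, mul_left_comm]

lemma pauliEnd_apply (χ : AddChar K ℂ) (w : ι → K × K) (v : (ι → K) → ℂ) (x : ι → K) :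
    pauliEnd χ w v x =
      χ ((fun i => (w i).2) ⬝ᵥ (x - fun i => (w i).1)) * v (x - fun i => (w i).1) := rfl

lemma pauliEnd_zero (χ : AddChar K ℂ) : pauliEnd χ (0 : ι → K × K) = 1 := by
  ext v x
  simp [pauliEnd_apply, ← Pi.zero_def]

lemma pauliEnd_mul_pauliEnd (χ : AddChar K ℂ) (w w' : ι → K × K) :
    pauliEnd χ w * pauliEnd χ w' =
      χ ((fun i => (w i).2) ⬝ᵥ fun i => (w' i).1) • pauliEnd χ (w + w') := by
  refine LinearMap.ext fun v => funext fun x => ?_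
  have hshift : x - (fun i => (w i).1) - (fun i => (w' i).1) = x - fun i => ((w + w') i).1 := by
    funext i; simp [sub_sub]
  have hphase : (fun i => (w i).2) ⬝ᵥ (x - fun i => (w i).1) +
      (fun i => (w' i).2) ⬝ᵥ (x - fun i => ((w + w') i).1) =
      ((fun i => (w i).2) ⬝ᵥ fun i => (w' i).1) +
        (fun i => ((w + w') i).2) ⬝ᵥ (x - fun i => ((w + w') i).1) := by
    simp only [dotProduct, ← Finset.sum_add_distrib, Pi.sub_apply, Pi.add_apply, Prod.fst_add,
      Prod.snd_add]
    exact Finset.sum_congr rfl fun i _ => by ring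
  rw [Module.End.mul_apply, LinearMap.smul_apply, Pi.smul_apply, smul_eq_mul, pauliEnd_apply,
    pauliEnd_apply, pauliEnd_apply, hshift, ← mul_assoc, ← mul_assoc, ← AddChar.map_add_eq_mul,
    ← AddChar.map_add_eq_mul, hphase]

/-- The symplectic form on words of labels, which governs the commutation of Pauli operators. -/
def sympForm : LinearMap.BilinForm K (ι → K × K) :=
  LinearMap.mk₂ K (fun w w' => ∑ i, ((w i).2 * (w' i).1 - (w' i).2 * (w i).1))
    (fun u v w => by
      simp only [Pi.add_apply, Prod.fst_add, Prod.snd_add, ← Finset.sum_add_distrib]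
      exact Finset.sum_congr rfl fun i _ => by ring)
    (fun r v w => by
      simp only [Pi.smul_apply, Prod.smul_fst, Prod.smul_snd, smul_eq_mul, Finset.mul_sum]
      exact Finset.sum_congr rfl fun i _ => by ring)
    (fun u v w => by
      simp only [Pi.add_apply, Prod.fst_add, Prod.snd_add, ← Finset.sum_add_distrib]
      exact Finset.sum_congr rfl fun i _ => by ring)
    fun r v w => by
      simp only [Pi.smul_apply, Prod.smul_fst, Prod.smul_snd, smul_eq_mul, Finset.mul_sum]
      exact Finset.sum_congr rfl fun i _ => by ring

lemma sympForm_apply (w w' : ι → K × K) :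
    sympForm w w' = ∑ i, ((w i).2 * (w' i).1 - (w' i).2 * (w i).1) := rfl

lemma pauliEnd_mul_pauliEnd_comm (χ : AddChar K ℂ) (w w' : ι → K × K) :
    pauliEnd χ w * pauliEnd χ w' = χ (sympForm w w') • (pauliEnd χ w' * pauliEnd χ w) := by
  have hform : sympForm w w' + ((fun i => (w' i).2) ⬝ᵥ fun i => (w i).1) =
      (fun i => (w i).2) ⬝ᵥ fun i => (w' i).1 := by
    simp only [sympForm_apply, dotProduct, ← Finset.sum_add_distrib, sub_add_cancel]
  rw [pauliEnd_mul_pauliEnd, pauliEnd_mul_pauliEnd, smul_smul, ← AddChar.map_add_eq_mul, hform,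
    add_comm w']

lemma star_pauliEnd_dotProduct_pauliEnd [Fintype K] [DecidableEq ι] (χ : AddChar K ℂ)
    (w : ι → K × K) (u v : (ι → K) → ℂ) :
    star (pauliEnd χ w u) ⬝ᵥ pauliEnd χ w v = star u ⬝ᵥ v := by
  refine Fintype.sum_equiv (Equiv.subRight fun i => (w i).1) _ _ fun x => ?_
  have hphase (r : K) : star (χ r) * χ r = 1 := by
    simp [Complex.conj_mul', AddChar.norm_apply]
  rw [Pi.star_apply, Pi.star_apply, pauliEnd_apply, pauliEnd_apply, star_mul',
    mul_mul_mul_comm, hphase, one_mul, Equiv.subRight_apply]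

lemma sum_addChar_dotProduct [Fintype K] [DecidableEq ι] [DecidableEq K] (hχ : χ ≠ 1)
    (t : ι → K) : ∑ b : ι → K, χ (b ⬝ᵥ t) = if t = 0 then (Fintype.card (ι → K) : ℂ) else 0 := by
  have hcoord (i : ι) : ∑ r : K, χ (r * t i) = if t i = 0 then (Fintype.card K : ℂ) else 0 := by
    rw [AddChar.sum_mulShift _ (AddChar.IsPrimitive.of_ne_one hχ), Nat.cast_ite, Nat.cast_zero]
  have hprod (b : ι → K) : χ (b ⬝ᵥ t) = ∏ i, χ (b i * t i) :=
    map_prod χ.toMonoidHom (fun i => Multiplicative.ofAdd (b i * t i)) Finset.univ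
  calc ∑ b : ι → K, χ (b ⬝ᵥ t) = ∏ i, ∑ r : K, χ (r * t i) := by
        simp only [hprod, Finset.prod_univ_sum, Fintype.piFinset_univ]
    _ = if t = 0 then (Fintype.card (ι → K) : ℂ) else 0 := by
        simp only [hcoord, Finset.prod_ite_zero, Finset.mem_univ, true_imp_iff, funext_iff,
          Pi.zero_apply, Finset.prod_const, Finset.card_univ, Fintype.card_fun, Nat.cast_pow]

lemma exists_eq_sum_mul_addChar_dotProduct [Fintype K] [DecidableEq ι] (hχ : χ ≠ 1)
    (f : (ι → K) → ℂ) : ∃ c : (ι → K) → ℂ, ∀ y, f y = ∑ b, c b * χ (b ⬝ᵥ y) := by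
  classical
  have hcard : (Fintype.card (ι → K) : ℂ) ≠ 0 := Nat.cast_ne_zero.2 Fintype.card_ne_zero
  refine ⟨fun b => (Fintype.card (ι → K) : ℂ)⁻¹ * ∑ s, χ (b ⬝ᵥ -s) * f s, fun y => Eq.symm ?_⟩
  calc ∑ b, (Fintype.card (ι → K) : ℂ)⁻¹ * (∑ s, χ (b ⬝ᵥ -s) * f s) * χ (b ⬝ᵥ y)
      = (Fintype.card (ι → K) : ℂ)⁻¹ * ∑ s, f s * ∑ b, χ (b ⬝ᵥ (y - s)) := by
        simp only [Finset.mul_sum, Finset.sum_mul]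
        rw [Finset.sum_comm]
        refine Finset.sum_congr rfl fun s _ => Finset.sum_congr rfl fun b _ => ?_
        rw [sub_eq_add_neg, dotProduct_add, AddChar.map_add_eq_mul]
        ring
    _ = f y := by
        simp only [sum_addChar_dotProduct hχ, sub_eq_zero, mul_ite, mul_zero, Finset.sum_ite_eq,
          Finset.mem_univ, if_true]
        field_simp

lemma trace_pauliEnd_eq_zero [Finite K] (hχ : χ ≠ 1) {w : ι → K × K} (hw : w ≠ 0) :
    LinearMap.trace ℂ _ (pauliEnd χ w) = 0 := by
  classical
  have := Fintype.ofFinite K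
  rw [LinearMap.trace_eq_matrix_trace ℂ (Pi.basisFun ℂ (ι → K))]
  simp only [Matrix.trace, Matrix.diag_apply, LinearMap.toMatrix_apply, Pi.basisFun_apply,
    Pi.basisFun_repr, pauliEnd_apply]
  by_cases ha : (fun i => (w i).1) = 0
  · have hb : (fun i => (w i).2) ≠ 0 := fun hb =>
      hw (funext fun i => Prod.ext (congrFun ha i) (congrFun hb i))
    simpa [ha, dotProduct_comm fun i => (w i).2, hb] using
      sum_addChar_dotProduct hχ fun i => (w i).2
  · refine Finset.sum_eq_zero fun x _ => ?_
    rw [Pi.single_eq_of_ne (by simpa using ha), mul_zero]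

lemma extend_zero_dotProduct {κ R : Type*} [Fintype κ] [Semiring R] {f : κ → ι}
    (hf : Function.Injective f) (b : κ → R) (y : ι → R) :
    Function.extend f b 0 ⬝ᵥ y = b ⬝ᵥ (y ∘ f) := by
  refine (Fintype.sum_of_injective f hf _ _ (fun i hi => ?_) fun k => ?_).symm
  · rw [Function.extend_apply' _ _ _ hi, Pi.zero_apply, zero_mul]
  · rw [hf.extend_apply, Function.comp_apply]

variable [Fintype K] [DecidableEq ι] {T : Finset ι} {E : Matrix (ι → K) (ι → K) ℂ}

lemma toMatrix'_pauliEnd_apply [DecidableEq K] (χ : AddChar K ℂ) (w : ι → K × K) (x y : ι → K) :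
    LinearMap.toMatrix' (pauliEnd χ w) x y =
      if ∀ i, x i = y i + (w i).1 then χ (∑ i, (w i).2 * y i) else 0 := by
  have hxy : x - (fun i => (w i).1) = y ↔ ∀ i, x i = y i + (w i).1 := by
    rw [sub_eq_iff_eq_add, funext_iff]; rfl
  rw [LinearMap.toMatrix'_apply, pauliEnd_apply, Pi.single_apply, mul_ite, mul_one, mul_zero]
  simp only [← hxy]
  split_ifs with h
  · rw [h]; rfl
  · rfl

lemma actsOn_toMatrix'_pauliEnd [DecidableEq K] (χ : AddChar K ℂ) {w : ι → K × K}
    (hw : ∀ i ∉ T, w i = 0) : ActsOn T (LinearMap.toMatrix' (pauliEnd χ w)) := by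
  refine ⟨LinearMap.toMatrix' (pauliEnd χ fun i : T => w i), fun x y =>
    ⟨fun hxy => ?_, fun hxy => ?_⟩⟩
  · have hphase : ∑ i, (w i).2 * y i = ∑ i : T, (w i).2 * y i := by
      rw [Finset.sum_coe_sort T fun i => (w i).2 * y i]
      exact (Finset.sum_subset T.subset_univ fun i _ hi => by simp [hw i hi]).symm
    have hshift : (∀ i, x i = y i + (w i).1) ↔ ∀ i : T, x i = y i + (w i).1 := by
      refine ⟨fun h i => h i, fun h i => ?_⟩
      by_cases hi : i ∈ T
      · exact h ⟨i, hi⟩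
      · rw [hxy i hi, hw i hi, Prod.fst_zero, add_zero]
    simp only [toMatrix'_pauliEnd_apply, hphase, hshift]
  · rw [toMatrix'_pauliEnd_apply, if_neg]
    exact fun h => hxy fun i hi => by rw [h i, hw i hi, Prod.fst_zero, add_zero]

lemma ActsOn.exists_mulVec_eq_sum_shift (hE : ActsOn T E) :
    ∃ g : (T → K) → (T → K) → ℂ, ∀ v x, E.mulVec v x =
      ∑ a, g a ((x - Function.extend Subtype.val a 0) ∘ Subtype.val) *
        v (x - Function.extend Subtype.val a 0) := by
  obtain ⟨M, hM⟩ := hE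
  have hext (a : T → K) (i : T) : Function.extend Subtype.val a (0 : ι → K) i = a i :=
    Subtype.val_injective.extend_apply _ _ _
  have hext' (a : T → K) {i : ι} (hi : i ∉ T) :
      Function.extend Subtype.val a (0 : ι → K) i = 0 :=
    Function.extend_apply' _ _ _ fun ⟨j, hj⟩ => hi (hj ▸ j.2)
  refine ⟨fun a s => M (s + a) s, fun v x => Eq.symm ?_⟩
  refine Fintype.sum_of_injective (fun a : T → K => x - Function.extend Subtype.val a 0)
    (fun a a' haa' => funext fun i => ?_) _ _ (fun y hy => ?_) fun a => ?_
  · rw [← hext a i, ← hext a' i, sub_right_injective haa']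
  · refine mul_eq_zero_of_left ((hM x y).2 fun hxy => hy ⟨fun i => x i - y i, funext fun i => ?_⟩) _
    by_cases hi : i ∈ T
    · simpa using congrArg (x i - ·) (hext (fun i => x i - y i) ⟨i, hi⟩)
    · simp [hext' _ hi, hxy i hi]
  · have hentry := (hM x (x - Function.extend Subtype.val a 0)).1 fun i hi => by simp [hext' a hi]
    simp only [hentry]
    congr 2
    funext i
    simp

lemma ActsOn.mulVecLin_mem_span_pauliEnd (hχ : χ ≠ 1) (hE : ActsOn T E) :
    E.mulVecLin ∈ Submodule.span ℂ (pauliEnd χ '' {w | ∀ i ∉ T, w i = 0}) := by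
  obtain ⟨g, hg⟩ := hE.exists_mulVec_eq_sum_shift
  choose c hc using fun a => exists_eq_sum_mul_addChar_dotProduct hχ (g a)
  let word (a b : T → K) (i : ι) : K × K :=
    (Function.extend Subtype.val a 0 i, Function.extend Subtype.val b 0 i)
  have hexpand : E.mulVecLin = ∑ a, ∑ b, c a b • pauliEnd χ (word a b) := by
    refine LinearMap.ext fun v => funext fun x => ?_
    simp only [Matrix.mulVecLin_apply, hg, hc, LinearMap.sum_apply, Finset.sum_apply,
      LinearMap.smul_apply, Pi.smul_apply, smul_eq_mul, pauliEnd_apply, Finset.sum_mul, word,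
      extend_zero_dotProduct Subtype.val_injective, mul_assoc]
  rw [hexpand]
  refine Submodule.sum_mem _ fun a _ => Submodule.sum_mem _ fun b _ =>
    Submodule.smul_mem _ _ (Submodule.subset_span ⟨word a b, fun i hi => ?_, rfl⟩)
  have hi' : ¬ ∃ j : T, (j : ι) = i := fun ⟨j, hj⟩ => hi (hj ▸ j.2)
  simp only [word, Function.extend_apply' _ _ _ hi', Pi.zero_apply, Prod.mk_zero_zero]

end PauliOperators

/-- On a minimal nonzero invariant subspace every member of the family acts as a scalar. -/
lemma exists_common_eigenvector {k V I : Type*} [Field k] [IsAlgClosed k] [AddCommGroup V]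
    [Module k V] [FiniteDimensional k V] [Nontrivial V] (f : I → Module.End k V)
    (hf : ∀ i j, Commute (f i) (f j)) : ∃ v : V, v ≠ 0 ∧ ∀ i, ∃ μ : k, f i v = μ • v := by
  obtain ⟨p, ⟨hp, hinv⟩, hmin⟩ := wellFounded_lt.has_min
    {p : Submodule k V | p ≠ ⊥ ∧ ∀ i, ∀ v ∈ p, f i v ∈ p} ⟨⊤, top_ne_bot, by simp⟩
  obtain ⟨v, hv, hv0⟩ := p.exists_mem_ne_zero_of_ne_bot hp
  refine ⟨v, hv0, fun i => ?_⟩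
  have : Nontrivial p := Submodule.nontrivial_iff_ne_bot.2 hp
  obtain ⟨μ, hμ⟩ := Module.End.exists_eigenvalue ((f i).restrict (hinv i))
  obtain ⟨w, hw⟩ := hμ.exists_hasEigenvector
  have hfw : f i w = μ • (w : V) := congrArg Subtype.val hw.apply_eq_smul
  have hle : p ≤ Module.End.eigenspace (f i) μ := by
    refine inf_eq_left.1 (eq_of_le_of_not_lt inf_le_left (hmin _ ⟨?_, fun j u hu => ⟨?_, ?_⟩⟩))
    · rw [Submodule.ne_bot_iff]
      exact ⟨w, ⟨w.2, Module.End.mem_eigenspace_iff.2 hfw⟩, by simpa using hw.2⟩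
    · exact hinv j u hu.1
    · refine Module.End.mem_eigenspace_iff.2 ?_
      rw [← Module.End.mul_apply, (hf i j).eq,
        Module.End.mul_apply, Module.End.mem_eigenspace_iff.1 hu.2, map_smul]
  exact ⟨μ, Module.End.mem_eigenspace_iff.1 (hle hv)⟩

section StabilizerCodes

open scoped ComplexOrder

variable {ι : Type*} [Fintype ι] {K : Type*} [Field K] {χ : AddChar K ℂ}
  {S : AddSubgroup (ι → K × K)} {θ : (ι → K × K) → ℂ}

/-- The words whose Pauli operators commute with those of all words of `S`: the symplectic dual
of `S`, relative to the character `χ`. -/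
def sympDual (χ : AddChar K ℂ) (S : AddSubgroup (ι → K × K)) : AddSubgroup (ι → K × K) where
  carrier := {w | ∀ s ∈ S, χ (sympForm s w) = 1}
  zero_mem' s _ := by rw [map_zero, AddChar.map_zero_eq_one]
  add_mem' hv hw s hs := by rw [map_add, AddChar.map_add_eq_mul, hv s hs, hw s hs, mul_one]
  neg_mem' hw s hs := by rw [map_neg, AddChar.map_neg_eq_inv, hw s hs, inv_one]

/-- The joint eigenspace, with eigenvalues `θ`, of the Pauli operators of the words of `S`. -/
def stabilizerSpace (χ : AddChar K ℂ) (S : AddSubgroup (ι → K × K)) (θ : (ι → K × K) → ℂ) :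
    Submodule ℂ ((ι → K) → ℂ) :=
  ⨅ w ∈ S, Module.End.eigenspace (pauliEnd χ w) (θ w)

lemma mem_stabilizerSpace {v : (ι → K) → ℂ} :
    v ∈ stabilizerSpace χ S θ ↔ ∀ w ∈ S, pauliEnd χ w v = θ w • v := by
  simp only [stabilizerSpace, Submodule.mem_iInf, Module.End.mem_eigenspace_iff]

lemma pauliEnd_mem_stabilizerSpace {w : ι → K × K} (hw : w ∈ sympDual χ S) {v : (ι → K) → ℂ}
    (hv : v ∈ stabilizerSpace χ S θ) : pauliEnd χ w v ∈ stabilizerSpace χ S θ := by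
  rw [mem_stabilizerSpace] at hv ⊢
  intro s hs
  rw [← Module.End.mul_apply, pauliEnd_mul_pauliEnd_comm, hw s hs, one_smul,
    Module.End.mul_apply, hv s hs, map_smul]

lemma eigenvalue_mul_eigenvalue (hQ : stabilizerSpace χ S θ ≠ ⊥) {w w' : ι → K × K} (hw : w ∈ S)
    (hw' : w' ∈ S) :
    θ w * θ w' = χ ((fun i => (w i).2) ⬝ᵥ fun i => (w' i).1) * θ (w + w') := by
  obtain ⟨v, hv, hv0⟩ := Submodule.exists_mem_ne_zero_of_ne_bot hQ
  rw [mem_stabilizerSpace] at hv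
  refine smul_left_injective ℂ hv0 ?_
  calc (θ w * θ w') • v = (pauliEnd χ w * pauliEnd χ w') v := by
        rw [Module.End.mul_apply, hv w' hw', map_smul, hv w hw, smul_smul, mul_comm]
    _ = _ := by
        rw [pauliEnd_mul_pauliEnd, LinearMap.smul_apply, hv _ (S.add_mem hw hw'), smul_smul]

lemma eigenvalue_zero (hQ : stabilizerSpace χ S θ ≠ ⊥) : θ 0 = 1 := by
  obtain ⟨v, hv, hv0⟩ := Submodule.exists_mem_ne_zero_of_ne_bot hQ
  have h0 := mem_stabilizerSpace.1 hv 0 S.zero_mem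
  rw [pauliEnd_zero, Module.End.one_apply] at h0
  exact smul_left_injective ℂ hv0 (h0.symm.trans (one_smul ℂ v).symm)

lemma exists_stabilizerSpace_ne_bot [Finite K] (hS : S ≤ sympDual χ S) :
    ∃ θ, stabilizerSpace χ S θ ≠ ⊥ := by
  obtain ⟨v, hv0, hv⟩ := exists_common_eigenvector (fun w : S => pauliEnd χ (w : ι → K × K))
    fun w w' => by
      rw [Commute, SemiconjBy, pauliEnd_mul_pauliEnd_comm, hS w'.2 w w.2, one_smul]
  choose θ hθ using hv
  refine ⟨Function.extend Subtype.val θ 0, (Submodule.ne_bot_iff _).2 ⟨v, ?_, hv0⟩⟩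
  rw [mem_stabilizerSpace]
  intro w hw
  rw [hθ ⟨w, hw⟩, ← Subtype.val_injective.extend_apply θ 0 ⟨w, hw⟩]

section Finite

variable [Finite K]

lemma star_mul_self_of_pauliEnd_eq_smul {w : ι → K × K} {v : (ι → K) → ℂ} (hv0 : v ≠ 0) {μ : ℂ}
    (hv : pauliEnd χ w v = μ • v) : star μ * μ = 1 := by
  classical
  have := Fintype.ofFinite K
  have hisometry := star_pauliEnd_dotProduct_pauliEnd χ w v v
  rw [hv, star_smul, smul_dotProduct, dotProduct_smul, smul_smul] at hisometry
  exact mul_right_cancel₀ (mt dotProduct_star_self_eq_zero.1 hv0)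
    (hisometry.trans (one_mul _).symm)

lemma star_eigenvalue_mul_self (hQ : stabilizerSpace χ S θ ≠ ⊥) {w : ι → K × K} (hw : w ∈ S) :
    star (θ w) * θ w = 1 := by
  obtain ⟨v, hv, hv0⟩ := Submodule.exists_mem_ne_zero_of_ne_bot hQ
  exact star_mul_self_of_pauliEnd_eq_smul hv0 (mem_stabilizerSpace.1 hv w hw)

lemma eigenvalue_ne_zero (hQ : stabilizerSpace χ S θ ≠ ⊥) {w : ι → K × K} (hw : w ∈ S) :
    θ w ≠ 0 :=
  right_ne_zero_of_mul_eq_one (star_eigenvalue_mul_self hQ hw)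

/-- The projection onto the joint eigenspace, as the average of the normalized Pauli operators. -/
noncomputable def stabilizerProj (χ : AddChar K ℂ) (S : AddSubgroup (ι → K × K)) [Fintype S]
    (θ : (ι → K × K) → ℂ) : Module.End ℂ ((ι → K) → ℂ) :=
  (Fintype.card S : ℂ)⁻¹ • ∑ w : S, (θ w)⁻¹ • pauliEnd χ w

lemma isProj_stabilizerProj [Fintype S] (hQ : stabilizerSpace χ S θ ≠ ⊥) :
    LinearMap.IsProj (stabilizerSpace χ S θ) (stabilizerProj χ S θ) := by
  refine ⟨fun v => mem_stabilizerSpace.2 fun s hs => ?_, fun v hv => ?_⟩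
  · simp only [stabilizerProj, LinearMap.smul_apply, LinearMap.sum_apply, map_smul, map_sum]
    rw [smul_comm (θ s)]
    refine congrArg _ ?_
    rw [Finset.smul_sum]
    refine Fintype.sum_equiv (Equiv.addLeft (⟨s, hs⟩ : S)) _ _ fun w => ?_
    have hmul := eigenvalue_mul_eigenvalue hQ hs w.2
    have hw := eigenvalue_ne_zero hQ w.2
    have hsw := eigenvalue_ne_zero hQ (S.add_mem hs w.2)
    rw [← Module.End.mul_apply, pauliEnd_mul_pauliEnd, LinearMap.smul_apply, smul_smul, smul_smul]
    congr 1
    simp only [Equiv.coe_addLeft, AddSubgroup.coe_add]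
    field_simp
    linear_combination -hmul
  · have hfix (w : S) : (θ w)⁻¹ • pauliEnd χ (w : ι → K × K) v = v := by
      rw [mem_stabilizerSpace.1 hv w w.2, smul_smul,
        inv_mul_cancel₀ (eigenvalue_ne_zero hQ w.2), one_smul]
    simp only [stabilizerProj, LinearMap.smul_apply, LinearMap.sum_apply, hfix, Finset.sum_const,
      Finset.card_univ]
    rw [← Nat.cast_smul_eq_nsmul ℂ, smul_smul,
      inv_mul_cancel₀ (Nat.cast_ne_zero.2 Fintype.card_ne_zero), one_smul]

lemma trace_pauliEnd_mul_stabilizerProj_eq_zero [Fintype S] (hχ : χ ≠ 1) {w : ι → K × K}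
    (hw : w ∉ S) : LinearMap.trace ℂ _ (pauliEnd χ w * stabilizerProj χ S θ) = 0 := by
  simp only [stabilizerProj, mul_smul_comm, Finset.mul_sum, pauliEnd_mul_pauliEnd, map_smul,
    map_sum]
  rw [Finset.sum_eq_zero, smul_zero]
  intro s _
  rw [trace_pauliEnd_eq_zero hχ, smul_zero, smul_zero]
  exact fun h => hw (eq_neg_of_add_eq_zero_left h ▸ S.neg_mem s.2)

end Finite

variable [Fintype K]

lemma finrank_stabilizerSpace_mul_card (hχ : χ ≠ 1) (hQ : stabilizerSpace χ S θ ≠ ⊥) :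
    Module.finrank ℂ (stabilizerSpace χ S θ) * Nat.card S = Fintype.card K ^ Fintype.card ι := by
  classical
  have := Fintype.ofFinite S
  have htrace := (isProj_stabilizerProj hQ).trace
  rw [stabilizerProj, map_smul, map_sum, Finset.sum_eq_single 0 (fun w _ hw => ?_) (by simp),
    AddSubgroup.coe_zero, eigenvalue_zero hQ, inv_one, one_smul, pauliEnd_zero,
    LinearMap.trace_one, Module.finrank_pi, smul_eq_mul,
    inv_mul_eq_iff_eq_mul₀ (Nat.cast_ne_zero.2 Fintype.card_ne_zero)] at htrace
  · rw [Nat.card_eq_fintype_card, ← Fintype.card_fun, mul_comm]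
    exact_mod_cast htrace.symm
  · rw [map_smul, trace_pauliEnd_eq_zero hχ (by simpa using hw), smul_zero]

variable [DecidableEq ι]

lemma star_dotProduct_pauliEnd_eq_zero {w : ι → K × K} (hw : w ∉ sympDual χ S)
    {u v : (ι → K) → ℂ} (hu : u ∈ stabilizerSpace χ S θ) (hv : v ∈ stabilizerSpace χ S θ) :
    star u ⬝ᵥ pauliEnd χ w v = 0 := by
  obtain rfl | hu0 := eq_or_ne u 0
  · rw [star_zero, zero_dotProduct]
  obtain ⟨s, hs, hsw⟩ : ∃ s ∈ S, χ (sympForm s w) ≠ 1 := by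
    by_contra! h
    exact hw h
  have hus := mem_stabilizerSpace.1 hu s hs
  have hvs := mem_stabilizerSpace.1 hv s hs
  have hinvariant : star u ⬝ᵥ pauliEnd χ w v =
      χ (sympForm s w) * (star u ⬝ᵥ pauliEnd χ w v) := by
    calc star u ⬝ᵥ pauliEnd χ w v
        = star (pauliEnd χ s u) ⬝ᵥ (pauliEnd χ s * pauliEnd χ w) v :=
          (star_pauliEnd_dotProduct_pauliEnd χ s u _).symm
      _ = star (θ s) * θ s * (χ (sympForm s w) * (star u ⬝ᵥ pauliEnd χ w v)) := by
          rw [pauliEnd_mul_pauliEnd_comm, LinearMap.smul_apply, Module.End.mul_apply, hus, hvs,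
            map_smul, star_smul, smul_dotProduct, dotProduct_smul, dotProduct_smul]
          simp only [smul_eq_mul]
          ring
      _ = _ := by rw [star_mul_self_of_pauliEnd_eq_smul hu0 hus, one_mul]
  by_contra h0
  exact hsw (mul_right_cancel₀ h0 (hinvariant.symm.trans (one_mul _).symm))

lemma exists_star_dotProduct_pauliEnd_eq_mul {w : ι → K × K} (hw : w ∈ sympDual χ S → w ∈ S) :
    ∃ r : ℂ, ∀ u ∈ stabilizerSpace χ S θ, ∀ v ∈ stabilizerSpace χ S θ,
      star u ⬝ᵥ pauliEnd χ w v = r * (star u ⬝ᵥ v) := by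
  by_cases hwS : w ∈ S
  · refine ⟨θ w, fun u _ v hv => ?_⟩
    rw [mem_stabilizerSpace.1 hv w hwS, dotProduct_smul, smul_eq_mul]
  · refine ⟨0, fun u hu v hv => ?_⟩
    rw [star_dotProduct_pauliEnd_eq_zero (mt hw hwS) hu hv, zero_mul]

lemma hasDistanceAtLeast_stabilizerSpace [DecidableEq K] (hχ : χ ≠ 1) {d : ℕ}
    (hd : ∀ w ∈ sympDual χ S, hammingNorm w < d → w ∈ S) :
    HasDistanceAtLeast (stabilizerSpace χ S θ) d := by
  intro T hT E hE
  have hspan := hE.mulVecLin_mem_span_pauliEnd hχ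
  simp only [← Matrix.mulVecLin_apply]
  generalize E.mulVecLin = f at hspan ⊢
  induction hspan using Submodule.span_induction with
  | mem f hf =>
    obtain ⟨w, hw, rfl⟩ := hf
    refine exists_star_dotProduct_pauliEnd_eq_mul fun hwS => hd w hwS (lt_of_le_of_lt ?_ hT)
    exact Finset.card_le_card fun i hi => by_contra fun hiT => (Finset.mem_filter.1 hi).2 (hw i hiT)
  | zero => exact ⟨0, fun u _ v _ => by simp⟩
  | add f g _ _ hf hg =>
    obtain ⟨r, hr⟩ := hf
    obtain ⟨s, hs⟩ := hg
    refine ⟨r + s, fun u hu v hv => ?_⟩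
    rw [LinearMap.add_apply, dotProduct_add, hr u hu v hv, hs u hu v hv, add_mul]
  | smul a f _ hf =>
    obtain ⟨r, hr⟩ := hf
    refine ⟨a * r, fun u hu v hv => ?_⟩
    rw [LinearMap.smul_apply, dotProduct_smul, hr u hu v hv, smul_eq_mul, mul_assoc]

lemma mem_of_hasDistanceAtLeast_stabilizerSpace [DecidableEq K] (hχ : χ ≠ 1)
    (hQ : stabilizerSpace χ S θ ≠ ⊥) {d : ℕ}
    (hd : HasDistanceAtLeast (stabilizerSpace χ S θ) d) {w : ι → K × K} (hw : w ∈ sympDual χ S)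
    (hwd : hammingNorm w < d) : w ∈ S := by
  classical
  have := Fintype.ofFinite S
  by_contra hwS
  obtain ⟨r, hr⟩ := hd {i | w i ≠ 0} hwd _ (actsOn_toMatrix'_pauliEnd χ fun i hi => by
    simpa using hi)
  simp only [LinearMap.toMatrix'_mulVec] at hr
  have hscalar : ∀ v ∈ stabilizerSpace χ S θ, pauliEnd χ w v = r • v := by
    intro v hv
    have hmem := sub_mem (pauliEnd_mem_stabilizerSpace hw hv) (Submodule.smul_mem _ r hv)
    rw [← sub_eq_zero, ← dotProduct_star_self_eq_zero, dotProduct_sub, hr _ hmem v hv,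
      dotProduct_smul, smul_eq_mul, sub_self]
  have hr0 : r ≠ 0 := by
    obtain ⟨v, hv, hv0⟩ := Submodule.exists_mem_ne_zero_of_ne_bot hQ
    exact right_ne_zero_of_mul_eq_one (star_mul_self_of_pauliEnd_eq_smul hv0 (hscalar v hv))
  have hproj := isProj_stabilizerProj hQ
  have hmul : pauliEnd χ w * stabilizerProj χ S θ = r • stabilizerProj χ S θ :=
    LinearMap.ext fun v => hscalar _ (hproj.map_mem v)
  have htrace := trace_pauliEnd_mul_stabilizerProj_eq_zero (θ := θ) hχ hwS
  rw [hmul, map_smul, hproj.trace, smul_eq_mul, mul_eq_zero, Nat.cast_eq_zero,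
    Submodule.finrank_eq_zero] at htrace
  exact htrace.elim hr0 hQ

theorem hasDistanceAtLeast_stabilizerSpace_iff [DecidableEq K] (hχ : χ ≠ 1)
    (hQ : stabilizerSpace χ S θ ≠ ⊥) {d : ℕ} :
    HasDistanceAtLeast (stabilizerSpace χ S θ) d ↔
      ∀ w ∈ sympDual χ S, hammingNorm w < d → w ∈ S :=
  ⟨fun hd _ => mem_of_hasDistanceAtLeast_stabilizerSpace hχ hQ hd,
    hasDistanceAtLeast_stabilizerSpace hχ⟩

end StabilizerCodes

section QuadraticExtension

variable {K F : Type*} [Field K] [Field F] [Algebra K F]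

lemma finrank_eq_two_of_linearEquiv (e : F ≃ₗ[K] K × K) : Module.finrank K F = 2 := by
  rw [e.finrank_eq, Module.finrank_prod, Module.finrank_self]

variable [Fintype K]

lemma sum_pow_card {I : Type*} (s : Finset I) (f : I → F) :
    (∑ i ∈ s, f i) ^ Fintype.card K = ∑ i ∈ s, f i ^ Fintype.card K :=
  map_sum (FiniteField.frobeniusAlgHom K F) f s

lemma pow_card_pow_card (hF : Module.finrank K F = 2) (u : F) :
    (u ^ Fintype.card K) ^ Fintype.card K = u := by
  have : Module.Finite K F := Module.finite_of_finrank_pos (by omega)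
  have : Finite F := Module.finite_of_finite K
  have := Fintype.ofFinite F
  rw [← pow_mul, ← sq, ← hF, ← Nat.card_eq_fintype_card, ← Module.natCard_eq_pow_finrank,
    Nat.card_eq_fintype_card, FiniteField.pow_card]

lemma algebraMap_norm_eq_pow_card_add_one (hF : Module.finrank K F = 2) (z : F) :
    algebraMap K F (Algebra.norm K z) = z ^ (Fintype.card K + 1) := by
  have : Module.Finite K F := Module.finite_of_finrank_pos (by omega)
  have : Finite F := Module.finite_of_finite K
  rw [FiniteField.algebraMap_norm_eq_pow_sum, hF, Finset.sum_range_succ, Finset.sum_range_one,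
    pow_zero, pow_one, Nat.card_eq_fintype_card, add_comm]

lemma exists_pow_card_add_one_eq (hF : Module.finrank K F = 2) {ι : Type*} (x : ι → K) :
    ∃ y : ι → F, ∀ i, y i ^ (Fintype.card K + 1) = algebraMap K F (x i) := by
  have : Module.Finite K F := Module.finite_of_finrank_pos (by omega)
  have : Finite F := Module.finite_of_finite K
  choose y hy using fun i => FiniteField.norm_surjective K F (x i)
  exact ⟨y, fun i => by rw [← hy i, algebraMap_norm_eq_pow_card_add_one hF]⟩

lemma exists_pow_card_ne_self (hF : Module.finrank K F = 2) :
    ∃ u : F, u ^ Fintype.card K ≠ u := by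
  by_contra! h
  have : Module.Finite K F := Module.finite_of_finrank_pos (by omega)
  have : Finite F := Module.finite_of_finite K
  have hone : FiniteField.frobeniusAlgHom K F = 1 := AlgHom.ext h
  have horder := FiniteField.orderOf_frobeniusAlgHom K F
  rw [hone, orderOf_one, hF] at horder
  omega

/-- The alternating `K`-bilinear forms on the plane `F` are all proportional. -/
lemma exists_pow_card_mul_sub_eq (e : F ≃ₗ[K] K × K) : ∃ δ : F, δ ≠ 0 ∧ ∀ u v : F,
    u ^ Fintype.card K * v - u * v ^ Fintype.card K =
      δ * algebraMap K F ((e u).2 * (e v).1 - (e v).2 * (e u).1) := by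
  set s := e.symm (1, 0)
  set t := e.symm (0, 1)
  have hcoord (u : F) : u = algebraMap K F (e u).1 * s + algebraMap K F (e u).2 * t := by
    apply e.injective
    rw [← Algebra.smul_def, ← Algebra.smul_def, map_add, map_smul, map_smul]
    simp [s, t]
  have hfrob (u : F) : u ^ Fintype.card K = algebraMap K F (e u).1 * s ^ Fintype.card K +
      algebraMap K F (e u).2 * t ^ Fintype.card K := by
    have := congrArg (FiniteField.frobeniusAlgHom K F) (hcoord u)
    rw [map_add, map_mul, map_mul, AlgHom.commutes, AlgHom.commutes] at this
    exact this
  have hform (u v : F) : u ^ Fintype.card K * v - u * v ^ Fintype.card K =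
      (t ^ Fintype.card K * s - t * s ^ Fintype.card K) *
        algebraMap K F ((e u).2 * (e v).1 - (e v).2 * (e u).1) := by
    rw [hfrob u, hfrob v, map_sub, map_mul, map_mul]
    linear_combination (algebraMap K F (e u).1 * s ^ Fintype.card K +
      algebraMap K F (e u).2 * t ^ Fintype.card K) * hcoord v -
      (algebraMap K F (e v).1 * s ^ Fintype.card K +
      algebraMap K F (e v).2 * t ^ Fintype.card K) * hcoord u
  refine ⟨_, fun h0 => ?_, hform⟩
  obtain ⟨u, hu⟩ := exists_pow_card_ne_self (finrank_eq_two_of_linearEquiv e)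
  have := hform u 1
  rw [h0, zero_mul, one_pow, mul_one, mul_one, sub_eq_zero] at this
  exact hu this

end QuadraticExtension

section StabilizerCodesOfWords

variable {ι K F : Type*} [Field K] [Field F] [Algebra K F]

/-- The labels of the Pauli operators belonging to the words of `D`, read in the coordinates
given by `e`. -/
def labelSpace (e : F ≃ₗ[K] K × K) (D : Submodule F (ι → F)) : Submodule K (ι → K × K) :=
  (D.restrictScalars K).map (LinearEquiv.piCongrRight fun _ : ι => e).toLinearMap

lemma comp_mem_labelSpace {e : F ≃ₗ[K] K × K} {D : Submodule F (ι → F)} {u : ι → F} :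
    e ∘ u ∈ labelSpace e D ↔ u ∈ D :=
  (LinearEquiv.piCongrRight fun _ : ι => e).injective.mem_set_image

lemma forall_mem_labelSpace {e : F ≃ₗ[K] K × K} {D : Submodule F (ι → F)}
    {p : (ι → K × K) → Prop} : (∀ w ∈ labelSpace e D, p w) ↔ ∀ c ∈ D, p (e ∘ c) :=
  Set.forall_mem_image

variable [Fintype ι]

lemma mem_sympDual_toAddSubgroup {χ : AddChar K ℂ} (hχ : χ ≠ 1) {S : Submodule K (ι → K × K)}
    {w : ι → K × K} : w ∈ sympDual χ S.toAddSubgroup ↔ ∀ s ∈ S, sympForm s w = 0 := by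
  refine ⟨fun hw s hs => by_contra fun h0 => ?_, fun hw s hs => ?_⟩
  · refine AddChar.IsPrimitive.of_ne_one hχ h0 (DFunLike.ext _ _ fun r => ?_)
    have := hw (r • s) (S.smul_mem r hs)
    rwa [map_smul, LinearMap.smul_apply, smul_eq_mul, mul_comm] at this
  · rw [hw s hs, AddChar.map_zero_eq_one]

variable [Fintype K]

lemma mem_hermitianDual_iff_sympForm (e : F ≃ₗ[K] K × K) (D : Submodule F (ι → F)) (u : ι → F) :
    u ∈ hermitianDual (Fintype.card K) D ↔ ∀ c ∈ D, sympForm (e ∘ c) (e ∘ u) = 0 := by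
  have hF := finrank_eq_two_of_linearEquiv e
  obtain ⟨δ, hδ, hform⟩ := exists_pow_card_mul_sub_eq e
  have hsum (c : ι → F) : ∑ i, c i ^ Fintype.card K * u i -
      (∑ i, c i ^ Fintype.card K * u i) ^ Fintype.card K =
        δ * algebraMap K F (sympForm (e ∘ c) (e ∘ u)) := by
    simp only [sum_pow_card, mul_pow, pow_card_pow_card hF, ← Finset.sum_sub_distrib, hform,
      sympForm_apply, map_sum, Finset.mul_sum, Function.comp_apply]
  refine ⟨fun hu c hc => ?_, fun hs c hc => by_contra fun h0 => ?_⟩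
  · have h0 := hsum c
    rw [hu c hc, zero_pow Fintype.card_ne_zero, sub_zero, zero_eq_mul, or_iff_right hδ] at h0
    exact (map_eq_zero _).1 h0
  · have hfixed : ∀ c ∈ D, ∑ i, c i ^ Fintype.card K * u i =
        (∑ i, c i ^ Fintype.card K * u i) ^ Fintype.card K := fun c hc => by
      rw [← sub_eq_zero, hsum c, hs c hc, map_zero, mul_zero]
    obtain ⟨r, hr⟩ := exists_pow_card_ne_self hF
    have hscale := hfixed (r • c) (D.smul_mem r hc)
    simp only [Pi.smul_apply, smul_eq_mul, mul_pow, mul_assoc, ← Finset.mul_sum] at hscale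
    rw [pow_card_pow_card hF, ← hfixed c hc] at hscale
    exact hr (mul_right_cancel₀ h0 hscale)

lemma comp_mem_sympDual_iff {χ : AddChar K ℂ} (hχ : χ ≠ 1) {e : F ≃ₗ[K] K × K}
    {D : Submodule F (ι → F)} {u : ι → F} :
    e ∘ u ∈ sympDual χ (labelSpace e D).toAddSubgroup ↔
      u ∈ hermitianDual (Fintype.card K) D := by
  rw [mem_sympDual_toAddSubgroup hχ, forall_mem_labelSpace, mem_hermitianDual_iff_sympForm e]

theorem exists_isStabilizerCodeOf [DecidableEq ι] [DecidableEq F] {χ : AddChar K ℂ} (hχ : χ ≠ 1)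
    (e : F ≃ₗ[K] K × K) {D : Submodule F (ι → F)}
    (hD : D ≤ hermitianDual (Fintype.card K) D) :
    ∃ Q : Submodule ℂ ((ι → K) → ℂ), IsStabilizerCodeOf χ e D Q ∧
      Module.finrank ℂ Q * Nat.card D = Fintype.card K ^ Fintype.card ι ∧
      ∀ d, HasDistanceAtLeast Q d ↔
        ∀ u ∈ hermitianDual (Fintype.card K) D, hammingNorm u < d → u ∈ D := by
  classical
  obtain ⟨θ, hθ⟩ := exists_stabilizerSpace_ne_bot (χ := χ) (S := (labelSpace e D).toAddSubgroup)
    (forall_mem_labelSpace.2 fun c hc => (comp_mem_sympDual_iff hχ).2 (hD hc))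
  have hcard : Nat.card (labelSpace e D) = Nat.card D :=
    Nat.card_image_of_injective (LinearEquiv.piCongrRight fun _ : ι => e).injective D
  have hnorm (u : ι → F) : hammingNorm (e ∘ u) = hammingNorm u :=
    hammingNorm_comp (fun _ => e) (fun _ => e.injective) fun _ => map_zero e
  refine ⟨stabilizerSpace χ (labelSpace e D).toAddSubgroup θ,
    ⟨hθ, fun c => θ (e ∘ c), fun v => mem_stabilizerSpace.trans forall_mem_labelSpace⟩, ?_,
    fun d => ?_⟩
  · exact hcard ▸ finrank_stabilizerSpace_mul_card hχ hθ
  · have hsurj : Function.Surjective fun u : ι → F => e ∘ u := e.surjective.comp_left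
    rw [hasDistanceAtLeast_stabilizerSpace_iff hχ hθ, hsurj.forall]
    simp only [comp_mem_sympDual_iff hχ, hnorm, Submodule.mem_toAddSubgroup, comp_mem_labelSpace]

end StabilizerCodesOfWords

section SingletonBound

variable {ι F : Type*} [Fintype ι] [Field F] [DecidableEq F]

lemma hammingNorm_le_card_of_forall_notMem {u : ι → F} {T : Finset ι}
    (h : ∀ i ∉ T, u i = 0) : hammingNorm u ≤ T.card :=
  Finset.card_le_card fun i hi => by_contra fun hiT => (Finset.mem_filter.1 hi).2 (h i hiT)

lemma exists_ne_zero_hammingNorm_le {C : Submodule F (ι → F)} {w : ℕ} (hw : w ≤ Fintype.card ι)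
    (hC : Fintype.card ι < Module.finrank F C + w) : ∃ c ∈ C, c ≠ 0 ∧ hammingNorm c ≤ w := by
  classical
  obtain ⟨T, -, rfl⟩ := Finset.exists_subset_card_eq (s := (Finset.univ : Finset ι)) hw
  have hker := LinearMap.ker_ne_bot_of_finrank_lt
    (f := (LinearMap.funLeft F F ((↑) : (Tᶜ : Finset ι) → ι)).domRestrict C) (by
      rw [Module.finrank_fintype_fun_eq_card, Fintype.card_coe, Finset.card_compl]
      omega)
  obtain ⟨c, hc, hc0⟩ := Submodule.exists_mem_ne_zero_of_ne_bot hker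
  refine ⟨c, c.2, Submodule.coe_eq_zero.not.2 hc0,
    hammingNorm_le_card_of_forall_notMem fun i hi => ?_⟩
  exact congrFun hc ⟨i, Finset.mem_compl.2 hi⟩

theorem isMDSCode_of_forall_lt_hammingNorm {C : Submodule F (ι → F)} {k : ℕ}
    (hk : k < Fintype.card ι) (hdim : Fintype.card ι ≤ Module.finrank F C + k)
    (hmin : ∀ c ∈ C, c ≠ 0 → k < hammingNorm c) :
    IsMDSCode C (Fintype.card ι - k) (k + 1) := by
  have hfinrank : Module.finrank F C ≤ Fintype.card ι - k := by
    by_contra! hlt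
    obtain ⟨c, hc, hc0, hck⟩ := exists_ne_zero_hammingNorm_le (C := C) hk.le (by omega)
    exact (hmin c hc hc0).not_ge hck
  obtain ⟨c, hc, hc0, hck⟩ := exists_ne_zero_hammingNorm_le (C := C) (w := k + 1) hk (by omega)
  refine ⟨⟨by omega, ⟨c, hc, hc0, hck.antisymm (hmin c hc hc0)⟩, ?_⟩, by omega⟩
  rintro w ⟨c, hc, hc0, rfl⟩
  exact hmin c hc hc0

end SingletonBound

section Strength

variable {ι F : Type*} [Field F]

/-- The words of `C` take arbitrary values on any `k` coordinates, that is, they form an orthogonal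
array of strength `k`. -/
def HasStrength (C : Submodule F (ι → F)) (k : ℕ) : Prop :=
  ∀ T : Finset ι, T.card = k → ∀ f : ι → F, ∃ c ∈ C, ∀ i ∈ T, c i = f i

lemma mem_rescale {C : Submodule F (ι → F)} {y u : ι → F} :
    u ∈ rescale y C ↔ ∃ c ∈ C, (fun i => y i * c i) = u :=
  Iff.rfl

variable {C : Submodule F (ι → F)} {k : ℕ}

protected lemma HasStrength.rescale (h : HasStrength C k) {y : ι → F} (hy : ∀ i, y i ≠ 0) :
    HasStrength (rescale y C) k := by
  intro T hT f
  obtain ⟨c, hc, hcf⟩ := h T hT fun i => (y i)⁻¹ * f i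
  refine ⟨_, mem_rescale.2 ⟨c, hc, rfl⟩, fun i hi => ?_⟩
  rw [hcf i hi, mul_inv_cancel_left₀ (hy i)]

lemma HasStrength.funLeft_surjective (h : HasStrength C k) {T : Finset ι} (hT : T.card = k) :
    Function.Surjective ((LinearMap.funLeft F F ((↑) : T → ι)).domRestrict C) := by
  intro f
  obtain ⟨g, hg⟩ :=
    LinearMap.funLeft_surjective_of_injective F F ((↑) : T → ι) Subtype.val_injective f
  obtain ⟨c, hc, hcg⟩ := h T hT g
  exact ⟨⟨c, hc⟩, (funext fun i : T => hcg i i.2).trans hg⟩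

variable [Fintype ι]

lemma HasStrength.finrank_eq (h : HasStrength C k) (hk : k ≤ Fintype.card ι)
    (hC : Module.finrank F C ≤ k) : Module.finrank F C = k := by
  obtain ⟨T, -, hT⟩ := Finset.exists_subset_card_eq (s := (Finset.univ : Finset ι)) hk
  refine hC.antisymm ?_
  simpa only [Module.finrank_fintype_fun_eq_card, Fintype.card_coe, hT] using
    LinearMap.finrank_le_finrank_of_surjective (h.funLeft_surjective hT)

lemma HasStrength.lt_hammingNorm_add [DecidableEq F] (h : HasStrength C k)
    (hk : k ≤ Fintype.card ι) (hC : Module.finrank F C ≤ k) {c : ι → F} (hc : c ∈ C)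
    (hc0 : c ≠ 0) : Fintype.card ι < hammingNorm c + k := by
  by_contra! hle
  have hcard : hammingNorm c + (Finset.univ.filter fun i => c i = 0).card = Fintype.card ι := by
    rw [hammingNorm, add_comm]
    exact Finset.card_filter_add_card_filter_not (s := Finset.univ) fun i => c i = 0
  obtain ⟨T, hTzero, hT⟩ := Finset.exists_subset_card_eq
    (show k ≤ (Finset.univ.filter fun i => c i = 0).card by omega)
  have hinj := (LinearMap.injective_iff_surjective_of_finrank_eq_finrank (by
    rw [h.finrank_eq hk hC, Module.finrank_fintype_fun_eq_card, Fintype.card_coe, hT])).2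
      (h.funLeft_surjective hT)
  refine hc0 (congrArg Subtype.val (@hinj ⟨c, hc⟩ 0 (funext fun i => ?_)))
  exact (Finset.mem_filter.1 (hTzero i.2)).2

lemma HasStrength.eq_zero_of_mem_hermitianDual [DecidableEq F] (h : HasStrength C k)
    (hk : k ≤ Fintype.card ι) {q : ℕ} (hq : q ≠ 0) {u : ι → F} (hu : u ∈ hermitianDual q C)
    (huk : hammingNorm u ≤ k) : u = 0 := by
  classical
  obtain ⟨T, hsupp, hT⟩ := Finset.exists_superset_card_eq huk hk
  have hout : ∀ i ∉ T, u i = 0 := fun i hi => by_contra fun h0 =>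
    hi (hsupp (Finset.mem_filter.2 ⟨Finset.mem_univ i, h0⟩))
  funext i
  by_cases hi : i ∈ T
  · obtain ⟨c, hc, hcT⟩ := h T hT (Pi.single i 1)
    have hsum := hu c hc
    rw [Finset.sum_eq_single i, hcT i hi, Pi.single_eq_same, one_pow, one_mul] at hsum
    · exact hsum
    · intro j _ hji
      by_cases hj : j ∈ T
      · rw [hcT j hj, Pi.single_eq_of_ne hji, zero_pow hq, zero_mul]
      · rw [hout j hj, mul_zero]
    · exact fun hi => absurd (Finset.mem_univ i) hi
  · exact hout i hi

variable (K : Type*) [Field K] [Fintype K] [Algebra K F]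

lemma card_le_finrank_hermitianDual_add (C : Submodule F (ι → F)) :
    Fintype.card ι ≤ Module.finrank F (hermitianDual (Fintype.card K) C) + Module.finrank F C := by
  let b := Module.finBasis F C
  let pairing : (ι → F) →ₗ[F] Fin (Module.finrank F C) → F :=
    Matrix.mulVecLin (.of fun s i => (b s : ι → F) i ^ Fintype.card K)
  have hker : LinearMap.ker pairing ≤ hermitianDual (Fintype.card K) C := by
    intro v hv c hc
    have hv' (s) : ∑ i, (b s : ι → F) i ^ Fintype.card K * v i = 0 := congrFun hv s
    have hc' (i : ι) : c i = ∑ s, b.repr ⟨c, hc⟩ s * (b s : ι → F) i := by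
      have := congrFun (congrArg C.subtype (b.sum_repr ⟨c, hc⟩)) i
      rw [map_sum, Finset.sum_apply] at this
      exact this.symm
    simp only [hc', sum_pow_card, mul_pow, Finset.sum_mul, mul_assoc]
    rw [Finset.sum_comm]
    simp only [← Finset.mul_sum, hv', mul_zero, Finset.sum_const_zero]
  have hdim := LinearMap.finrank_range_add_finrank_ker pairing
  have hrange := (LinearMap.range pairing).finrank_le
  rw [Module.finrank_fintype_fun_eq_card] at hdim hrange
  rw [Fintype.card_fin] at hrange
  have := Submodule.finrank_mono hker
  omega

theorem HasStrength.isMDSCode_hermitianDual [DecidableEq F] (h : HasStrength C k)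
    (hk : k < Fintype.card ι) (hC : Module.finrank F C ≤ k) :
    IsMDSCode (hermitianDual (Fintype.card K) C) (Fintype.card ι - k) (k + 1) := by
  refine isMDSCode_of_forall_lt_hammingNorm hk ?_ fun u hu hu0 => by_contra fun hle => ?_
  · have := card_le_finrank_hermitianDual_add K C
    omega
  · exact hu0 (h.eq_zero_of_mem_hermitianDual hk.le Fintype.card_ne_zero hu (not_lt.1 hle))

end Strength

section PunctureCode

variable {ι K F : Type*} [Fintype ι] [Field K] [Field F] [Algebra K F]

lemma mem_punctureCode_iff {q : ℕ} {C : Submodule F (ι → F)} {x : ι → K} :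
    x ∈ punctureCode K q C ↔
      ∀ c ∈ C, ∀ c' ∈ C, ∑ i, algebraMap K F (x i) * (c i ^ q * c' i) = 0 := by
  simp only [mul_comm (algebraMap K F _)]
  refine ⟨fun hx c hc c' hc' => hx _ (Submodule.subset_span ⟨c, hc, c', hc', rfl⟩),
    fun hx s hs => ?_⟩
  induction hs using Submodule.span_induction with
  | mem s hs =>
    obtain ⟨c, hc, c', hc', rfl⟩ := hs
    exact hx c hc c' hc'
  | zero => simp only [Pi.zero_apply, zero_mul, Finset.sum_const_zero]
  | add s t _ _ hs ht => simp only [Pi.add_apply, add_mul, Finset.sum_add_distrib, hs, ht, add_zero]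
  | smul a s _ hs =>
    simp only [Pi.smul_apply, smul_eq_mul, mul_assoc, ← Finset.mul_sum, hs, mul_zero]

lemma rescale_le_hermitianDual_rescale {q : ℕ} {C : Submodule F (ι → F)} {x : ι → K}
    (hx : x ∈ punctureCode K q C) {y : ι → F}
    (hy : ∀ i, y i ^ (q + 1) = algebraMap K F (x i)) :
    rescale y C ≤ hermitianDual q (rescale y C) := by
  intro u hu v hv
  obtain ⟨c', hc', rfl⟩ := mem_rescale.1 hu
  obtain ⟨c, hc, rfl⟩ := mem_rescale.1 hv
  rw [← mem_punctureCode_iff.1 hx c hc c' hc']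
  refine Finset.sum_congr rfl fun i _ => ?_
  rw [← hy i]
  ring

end PunctureCode

section QuantumMDSCodes

variable {ι : Type*} [Fintype ι] [DecidableEq ι] {K F : Type*} [Field K] [Fintype K]
  [Field F] [Algebra K F] {χ : AddChar K ℂ} {k : ℕ}

theorem HasStrength.exists_isQuantumMDSCode (hχ : χ ≠ 1) (e : F ≃ₗ[K] K × K)
    {D : Submodule F (ι → F)} (h : HasStrength D k) (hD : Module.finrank F D ≤ k)
    (hk : 2 * k < Fintype.card ι) (hself : D ≤ hermitianDual (Fintype.card K) D) :
    ∃ Q : Submodule ℂ ((ι → K) → ℂ), IsStabilizerCodeOf χ e D Q ∧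
      IsQuantumMDSCode Q (Fintype.card ι - 2 * k) (k + 1) := by
  classical
  have hkn : k ≤ Fintype.card ι := by omega
  obtain ⟨Q, hQ, hcard, hdist⟩ := exists_isStabilizerCodeOf hχ e hself
  obtain ⟨⟨-, ⟨u, hu, hu0, huk⟩, -⟩, -⟩ := h.isMDSCode_hermitianDual K (by omega) hD
  refine ⟨Q, hQ, ⟨?_, (hdist _).2 fun u hu huk => ?_, fun hdet => ?_⟩, by omega⟩
  · have hDcard : Nat.card D = Fintype.card K ^ (2 * k) := by
      have : Module.Finite K F := Module.Finite.equiv e.symm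
      rw [Module.natCard_eq_pow_finrank (K := F), h.finrank_eq hkn hD,
        Module.natCard_eq_pow_finrank (K := K), finrank_eq_two_of_linearEquiv e,
        Nat.card_eq_fintype_card, pow_mul]
    rw [hDcard, ← Nat.sub_add_cancel hk.le, pow_add] at hcard
    exact Nat.eq_of_mul_eq_mul_right (Nat.pow_pos Fintype.card_pos) hcard
  · rw [h.eq_zero_of_mem_hermitianDual hkn Fintype.card_ne_zero hu (by omega)]
    exact zero_mem D
  · have huD := (hdist _).1 hdet u hu (by omega)
    have := h.lt_hammingNorm_add hkn hD huD hu0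
    omega

theorem HasStrength.exists_isQuantumMDSCode_rescale (hχ : χ ≠ 1) (e : F ≃ₗ[K] K × K)
    {C : Submodule F (ι → F)} (h : HasStrength C k) (hC : Module.finrank F C ≤ k)
    (hk : 2 * k < Fintype.card ι) {x : ι → K} (hx : x ∈ punctureCode K (Fintype.card K) C)
    (hx0 : ∀ i, x i ≠ 0) :
    ∃ y : ι → F, (∀ i, y i ^ (Fintype.card K + 1) = algebraMap K F (x i)) ∧
      rescale y C ≤ hermitianDual (Fintype.card K) (rescale y C) ∧
      ∃ Q : Submodule ℂ ((ι → K) → ℂ), IsStabilizerCodeOf χ e (rescale y C) Q ∧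
        IsQuantumMDSCode Q (Fintype.card ι - 2 * k) (k + 1) := by
  obtain ⟨y, hy⟩ := exists_pow_card_add_one_eq (finrank_eq_two_of_linearEquiv e) x
  have hy0 (i : ι) : y i ≠ 0 := fun h0 => hx0 i <| (map_eq_zero (algebraMap K F)).1 <| by
    rw [← hy i, h0, zero_pow (Nat.succ_ne_zero _)]
  have hself := rescale_le_hermitianDual_rescale hx hy
  exact ⟨y, hy, hself, (h.rescale hy0).exists_isQuantumMDSCode hχ e
    ((Submodule.finrank_map_le _ _).trans hC) hk hself⟩

end QuantumMDSCodes

section Forms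

variable (R M : Type*) [CommRing R] [AddCommGroup M] [Module R M]

/-- The linear forms on `M` as a subspace of the algebra of functions `M → R`. Its power
`linForms R M ^ m` is the space of functions given by forms of degree `m`. -/
def linForms : Submodule R (M → R) := LinearMap.range (LinearMap.ltoFun R M R R)

variable {R M}

lemma coe_mem_linForms (l : M →ₗ[R] R) : (l : M → R) ∈ linForms R M := ⟨l, rfl⟩

lemma comp_mem_linForms_pow {N : Type*} [AddCommGroup N] [Module R N] {m : ℕ} {f : N → R}
    (hf : f ∈ linForms R N ^ m) (T : M →ₗ[R] N) : f ∘ T ∈ linForms R M ^ m := by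
  induction hf using Submodule.pow_induction_on_left' with
  | algebraMap r => exact (pow_zero (linForms R M)).symm ▸ Submodule.algebraMap_mem r
  | add f g i _ _ hf hg => exact add_mem hf hg
  | mem_mul l hl i f _ hf =>
    obtain ⟨l, rfl⟩ := hl
    rw [Nat.succ_eq_add_one, pow_succ']
    exact Submodule.mul_mem_mul (coe_mem_linForms (l ∘ₗ T)) hf

lemma map_smul_of_mem_linForms_pow {m : ℕ} {f : M → R} (hf : f ∈ linForms R M ^ m) (a : R)
    (z : M) : f (a • z) = a ^ m * f z := by
  induction hf using Submodule.pow_induction_on_left' with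
  | algebraMap r => rw [pow_zero, one_mul]; rfl
  | add f g i _ _ hf hg => rw [Pi.add_apply, Pi.add_apply, hf, hg, mul_add]
  | mem_mul l hl i f _ hf =>
    obtain ⟨l, rfl⟩ := hl
    rw [Pi.mul_apply, Pi.mul_apply, hf, LinearMap.ltoFun_apply, map_smul, smul_eq_mul,
      Nat.succ_eq_add_one]
    ring

lemma mul_mem_linForms_pow {m n : ℕ} {f g : M → R} (hf : f ∈ linForms R M ^ m)
    (hg : g ∈ linForms R M ^ n) : f * g ∈ linForms R M ^ (m + n) := by
  rw [pow_add]
  exact Submodule.mul_mem_mul hf hg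

lemma pow_mem_linForms_pow {m : ℕ} {f : M → R} (hf : f ∈ linForms R M ^ m) (n : ℕ) :
    f ^ n ∈ linForms R M ^ (m * n) := by
  rw [pow_mul]
  exact Submodule.pow_mem_pow _ hf n

lemma prod_mem_linForms_pow {ι : Type*} (s : Finset ι) (l : ι → M →ₗ[R] R) :
    ∏ i ∈ s, (l i : M → R) ∈ linForms R M ^ s.card := by
  classical
  induction s using Finset.induction_on with
  | empty => exact (pow_zero (linForms R M)).symm ▸ Submodule.one_le.1 le_rfl
  | insert i s hi ih =>
    rw [Finset.prod_insert hi, Finset.card_insert_of_notMem hi, pow_succ']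
    exact Submodule.mul_mem_mul (coe_mem_linForms (l i)) ih

lemma det_mem_linForms_pow {n : Type*} [Fintype n] [DecidableEq n] (T : M →ₗ[R] Matrix n n R) :
    (fun z => (T z).det) ∈ linForms R M ^ Fintype.card n := by
  have hdet : (fun z => (T z).det) = ∑ σ : Equiv.Perm n, ((Equiv.Perm.sign σ : ℤ) : R) •
      ∏ i, (Matrix.entryLinearMap R R (σ i) i ∘ₗ T : M → R) := by
    funext z
    rw [Matrix.det_apply', Finset.sum_apply]
    refine Finset.sum_congr rfl fun σ _ => ?_
    rw [Pi.smul_apply, Finset.prod_apply, smul_eq_mul]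
    rfl
  rw [hdet]
  exact sum_mem fun σ _ => Submodule.smul_mem _ _ (prod_mem_linForms_pow Finset.univ _)

lemma linForms_pow_eq_map {ι : Type*} [Finite ι] (b : Module.Basis ι R M) (m : ℕ) :
    linForms R M ^ m = (MvPolynomial.homogeneousSubmodule ι R m).map
      (MvPolynomial.aeval fun i => (b.coord i : M → R)).toLinearMap := by
  classical
  have hlin : linForms R M = (MvPolynomial.homogeneousSubmodule ι R 1).map
      (MvPolynomial.aeval fun i => (b.coord i : M → R)).toLinearMap := by
    rw [linForms, LinearMap.range_eq_map, ← b.dualBasis.span_eq, Submodule.map_span,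
      MvPolynomial.homogeneousSubmodule_one_eq_span_X, Submodule.map_span, ← Set.range_comp,
      ← Set.range_comp, b.coe_dualBasis]
    congr 2
    funext i
    exact (MvPolynomial.aeval_X _ i).symm
  rw [hlin, ← Submodule.map_pow, MvPolynomial.homogeneousSubmodule_one_pow]

lemma mem_linForms_pow_iff {ι : Type*} [Finite ι] (b : Module.Basis ι R M) {m : ℕ} {f : M → R} :
    f ∈ linForms R M ^ m ↔
      ∃ p : MvPolynomial ι R, p.IsHomogeneous m ∧ ∀ z, MvPolynomial.eval (b.repr z) p = f z := by
  have heval (z : M) (p : MvPolynomial ι R) :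
      MvPolynomial.aeval (fun i => (b.coord i : M → R)) p z = MvPolynomial.eval (b.repr z) p := by
    rw [← MvPolynomial.aeval_eq_eval]
    refine DFunLike.congr_fun (F := MvPolynomial ι R →ₐ[R] R)
      (f := (Pi.evalAlgHom R (fun _ : M => R) z).comp (MvPolynomial.aeval _))
      (MvPolynomial.algHom_ext fun i => ?_) p
    rw [AlgHom.comp_apply, MvPolynomial.aeval_X, MvPolynomial.aeval_X]
    rfl
  rw [linForms_pow_eq_map b]
  simp only [Submodule.mem_map, MvPolynomial.mem_homogeneousSubmodule, AlgHom.toLinearMap_apply,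
    funext_iff, heval]

end Forms

section FormsOverFields

variable {F E : Type*} [Field F] [AddCommGroup E] [Module F E] [Module.Finite F E]

lemma finrank_homogeneousSubmodule_le (σ : Type*) [Fintype σ] (m : ℕ) :
    Module.finrank F (MvPolynomial.homogeneousSubmodule σ F m) ≤
      (Fintype.card σ).multichoose m := by
  classical
  have hset : {d : σ →₀ ℕ | d.degree = m} = ↑((Finset.univ : Finset σ).finsuppAntidiag m) := by
    ext d
    simp [Finsupp.degree_eq_sum]
  rw [MvPolynomial.homogeneousSubmodule_eq_finsupp_supported,
    AddMonoidAlgebra.supported_eq_span_single, hset, ← Finset.coe_image]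
  exact (finrank_span_finset_le_card _).trans (Finset.card_image_le.trans
    (Finset.card_finsuppAntidiag_nat_eq_multichoose m).le)

instance finite_linForms_pow (m : ℕ) :
    Module.Finite F (linForms F E ^ m : Submodule F (E → F)) := by
  have := Module.Finite.iff_fg.2
    (MvPolynomial.homogeneousSubmodule_fg (Fin (Module.finrank F E)) F m)
  rw [linForms_pow_eq_map (Module.finBasis F E)]
  exact Module.Finite.map _ _

variable (F E) in
lemma finrank_linForms_pow_le (m : ℕ) :
    Module.finrank F (linForms F E ^ m : Submodule F (E → F)) ≤
      (Module.finrank F E).multichoose m := by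
  have := Module.Finite.iff_fg.2
    (MvPolynomial.homogeneousSubmodule_fg (Fin (Module.finrank F E)) F m)
  rw [linForms_pow_eq_map (Module.finBasis F E)]
  refine (Submodule.finrank_map_le _ _).trans ?_
  simpa only [Fintype.card_fin] using finrank_homogeneousSubmodule_le (Fin (Module.finrank F E)) m

lemma sum_eq_zero_of_mem_linForms_pow [Fintype F] [Fintype E] {m : ℕ}
    (hm : m < (Fintype.card F - 1) * Module.finrank F E) {f : E → F}
    (hf : f ∈ linForms F E ^ m) : ∑ z, f z = 0 := by
  let b := Module.finBasis F E
  obtain ⟨p, hp, hpf⟩ := (mem_linForms_pow_iff b).1 hf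
  calc ∑ z, f z = ∑ x, MvPolynomial.eval x p :=
        Fintype.sum_equiv b.equivFun.toEquiv _ _ fun z => (hpf z).symm
    _ = 0 := MvPolynomial.sum_eval_eq_zero p (by
        rw [Fintype.card_fin]
        exact hp.totalDegree_le.trans_lt hm)

end FormsOverFields

lemma norm_mem_linForms_pow (F E : Type*) [Field F] [Field E] [Algebra F E] [Module.Finite F E] :
    (fun z : E => Algebra.norm F z) ∈ linForms F E ^ Module.finrank F E := by
  let b := Module.finBasis F E
  simp only [Algebra.norm_eq_matrix_det b]
  simpa only [Fintype.card_fin, AlgHom.toLinearMap_apply] using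
    det_mem_linForms_pow (Algebra.leftMulMatrix b).toLinearMap

section FormCodes

variable {ι F E : Type*} [Field F] [AddCommGroup E] [Module F E]

variable (F) in
/-- The evaluation code of the forms of degree `m` at the points `P`. -/
def formCode (P : ι → E) (m : ℕ) : Submodule F (ι → F) :=
  (linForms F E ^ m).map (LinearMap.funLeft F F P)

lemma mem_formCode {P : ι → E} {m : ℕ} {c : ι → F} :
    c ∈ formCode F P m ↔ ∃ f ∈ linForms F E ^ m, f ∘ P = c :=
  Iff.rfl

lemma finrank_formCode_le (P : ι → E) (m : ℕ) [Module.Finite F E] :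
    Module.finrank F (formCode F P m) ≤ (Module.finrank F E).multichoose m :=
  (Submodule.finrank_map_le _ _).trans (finrank_linForms_pow_le F E m)

lemma hasStrength_of_forall_exists_ne_zero {C : Submodule F (ι → F)} {k : ℕ}
    (h : ∀ T : Finset ι, T.card = k → ∀ i ∈ T, ∃ c ∈ C, c i ≠ 0 ∧ ∀ j ∈ T, j ≠ i → c j = 0) :
    HasStrength C k := by
  intro T hT f
  choose! c hc hci hcj using h T hT
  refine ⟨∑ i ∈ T, (f i / c i i) • c i, sum_mem fun i hi => C.smul_mem _ (hc i hi),
    fun j hj => ?_⟩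
  rw [Finset.sum_apply, Finset.sum_eq_single_of_mem j hj, Pi.smul_apply, smul_eq_mul,
    div_mul_cancel₀ _ (hci j hj)]
  intro i hi hij
  rw [Pi.smul_apply, hcj i hi j hj hij.symm, smul_zero]

theorem hasStrength_formCode {P : ι → E} (hP : ∀ i j, i ≠ j → P i ∉ Submodule.span F {P j})
    (m : ℕ) : HasStrength (formCode F P m) (m + 1) := by
  classical
  refine hasStrength_of_forall_exists_ne_zero fun T hT i hi => ?_
  have hsep : ∀ j, ∃ l : E →ₗ[F] F, j ≠ i → l (P i) ≠ 0 ∧ l (P j) = 0 := fun j => by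
    by_cases hj : j = i
    · exact ⟨0, fun h => absurd hj h⟩
    · obtain ⟨l, hl, hker⟩ := Submodule.exists_le_ker_of_notMem (hP i j (Ne.symm hj))
      exact ⟨l, fun _ => ⟨hl, hker (Submodule.mem_span_singleton_self _)⟩⟩
  choose l hl using hsep
  have hprod := prod_mem_linForms_pow (T.erase i) l
  rw [Finset.card_erase_of_mem hi, hT, Nat.add_sub_cancel] at hprod
  refine ⟨_, mem_formCode.2 ⟨_, hprod, rfl⟩, ?_, fun j hj hji => ?_⟩
  · rw [Function.comp_apply, Finset.prod_apply]
    exact Finset.prod_ne_zero_iff.2 fun j hj => (hl j (Finset.ne_of_mem_erase hj)).1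
  · rw [Function.comp_apply, Finset.prod_apply]
    exact Finset.prod_eq_zero (Finset.mem_erase.2 ⟨hji, hj⟩) (hl j hji).2

variable (F) in
/-- The vectors `P i` represent the points of the projective space of `E`, each of them once:
every nonzero vector of `E` is a nonzero multiple of `P i`, for a unique `i` and scalar. -/
def IsProjectiveSystem (P : ι → E) : Prop :=
  Set.BijOn (fun p : Fˣ × ι => p.1 • P p.2) Set.univ {0}ᶜ

variable {P : ι → E}

lemma IsProjectiveSystem.ne_zero (hP : IsProjectiveSystem F P) (i : ι) : P i ≠ 0 := by
  simpa using hP.mapsTo (Set.mem_univ (1, i))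

lemma IsProjectiveSystem.notMem_span_singleton (hP : IsProjectiveSystem F P) (i j : ι)
    (hij : i ≠ j) : P i ∉ Submodule.span F {P j} := by
  intro hmem
  obtain ⟨a, ha⟩ := Submodule.mem_span_singleton.1 hmem
  have ha0 : a ≠ 0 := by
    rintro rfl
    exact hP.ne_zero i (by rw [← ha, zero_smul])
  have hpair := hP.injOn (Set.mem_univ (Units.mk0 a ha0, j)) (Set.mem_univ (1, i))
    (ha.trans (one_smul _ _).symm)
  exact hij (congrArg Prod.snd hpair).symm

lemma IsProjectiveSystem.sum_eq_zero [Fintype ι] [Fintype F] [Module.Finite F E]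
    (hP : IsProjectiveSystem F P) (hE : 1 < Module.finrank F E) {w : E → F}
    (hw : w ∈ linForms F E ^ (Fintype.card F - 1)) : ∑ i, w (P i) = 0 := by
  classical
  have : Finite E := Module.finite_of_finite F
  have := Fintype.ofFinite E
  have hF : 0 < Fintype.card F - 1 := Nat.sub_pos_of_lt Fintype.one_lt_card
  have hw0 : w 0 = 0 := by
    have := map_smul_of_mem_linForms_pow hw 0 0
    rwa [zero_smul, zero_pow hF.ne', zero_mul] at this
  have hsum : ∑ p : Fˣ × ι, w (P p.2) = ∑ z, w z := by
    refine Fintype.sum_of_injective (fun p : Fˣ × ι => p.1 • P p.2)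
      (Set.injOn_univ.1 hP.injOn) _ _ (fun z hz => ?_) fun p => ?_
    · by_cases hz0 : z = 0
      · rw [hz0, hw0]
      · exact absurd (Set.image_univ ▸ hP.surjOn hz0) hz
    · rw [Units.smul_def, map_smul_of_mem_linForms_pow hw,
        FiniteField.pow_card_sub_one_eq_one _ p.1.ne_zero, one_mul]
  have hcard : ((Fintype.card F - 1 : ℕ) : F) = -1 := by
    rw [Nat.cast_sub Fintype.card_pos, FiniteField.cast_card_eq_zero, zero_sub, Nat.cast_one]
  simpa only [sum_eq_zero_of_mem_linForms_pow (lt_mul_of_one_lt_right hF hE) hw,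
    Fintype.sum_prod_type, Finset.sum_const, Finset.card_univ, Fintype.card_units, nsmul_eq_mul,
    hcard, neg_one_mul, neg_eq_zero] using hsum

end FormCodes

section PowersOfGenerator

variable {F E : Type*} [Field F] [Fintype F] [Field E] [Algebra F E]

lemma isProjectiveSystem_pow (hE : Module.finrank F E = 2) {η : Eˣ}
    (hη : ∀ x, x ∈ Subgroup.zpowers η) {n : ℕ} (hn : n = Fintype.card F + 1) :
    IsProjectiveSystem F fun i : Fin n => (η : E) ^ (i : ℕ) := by
  classical
  subst hn
  have : Module.Finite F E := Module.finite_of_finrank_pos (by omega)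
  have : Finite E := Module.finite_of_finite F
  have := Fintype.ofFinite E
  let scale (p : Fˣ × Fin (Fintype.card F + 1)) : Eˣ :=
    Units.map (algebraMap F E) p.1 * η ^ (p.2 : ℕ)
  have hsurj : Function.Surjective scale := fun x => by
    obtain ⟨s, rfl⟩ := mem_powers_iff_mem_zpowers.2 (hη x)
    refine ⟨(Units.map (Algebra.norm F) η ^ (s / (Fintype.card F + 1)),
      ⟨s % (Fintype.card F + 1), Nat.mod_lt _ (Nat.succ_pos _)⟩), Units.ext ?_⟩
    simp only [scale, Units.val_mul, Units.coe_map, MonoidHom.coe_coe, Units.val_pow_eq_pow_val,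
      map_pow, algebraMap_norm_eq_pow_card_add_one hE, ← pow_mul, ← pow_add, Nat.div_add_mod]
  have hcard : Fintype.card (Fˣ × Fin (Fintype.card F + 1)) = Fintype.card Eˣ := by
    rw [Fintype.card_prod, Fintype.card_units, Fintype.card_units, Fintype.card_fin,
      Module.card_eq_pow_finrank (K := F) (V := E), hE, mul_comm, ← Nat.sq_sub_sq, one_pow]
  have hbij : Function.Bijective scale :=
    (Fintype.bijective_iff_surjective_and_card scale).2 ⟨hsurj, hcard⟩
  have hval (p) : p.1 • (η : E) ^ (p.2 : ℕ) = scale p := Algebra.smul_def _ _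
  simp only [IsProjectiveSystem, hval]
  refine ⟨fun p _ => (scale p).ne_zero, (Units.val_injective.comp hbij.1).injOn, fun z hz => ?_⟩
  obtain ⟨p, hp⟩ := hbij.2 (Units.mk0 z hz)
  exact ⟨p, Set.mem_univ p, congrArg Units.val hp⟩

end PowersOfGenerator

section Constacyclicity

variable {F : Type*} [Field F] {n : ℕ} [NeZero n]

/-- The Hermitian adjoint of a constacyclic shift is a constacyclic shift in the opposite
direction. -/
lemma isConstacyclic_hermitianDual {C : Submodule F (Fin n → F)} {γ : F} (hγ : γ ≠ 0)
    (hC : ∀ c ∈ C, (fun i => if i + 1 = 0 then γ * c (i + 1) else c (i + 1)) ∈ C) (q : ℕ) :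
    IsConstacyclic (hermitianDual q C) := by
  refine ⟨γ ^ q, pow_ne_zero q hγ, fun v hv c hc => ?_⟩
  rw [← hv _ (hC c hc), ← Equiv.sum_comp (Equiv.addRight 1)]
  refine Finset.sum_congr rfl fun i _ => ?_
  simp only [constaShift, Equiv.coe_addRight, add_sub_cancel_right]
  split_ifs <;> ring

lemma isConstacyclic_hermitianDual_formCode {E : Type*} [Field E] [Algebra F E] {η : E} {a : F}
    (ha : a ≠ 0) (hη : η ^ n = algebraMap F E a) (m q : ℕ) :
    IsConstacyclic (hermitianDual q (formCode F (fun i : Fin n => η ^ (i : ℕ)) m)) := by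
  refine isConstacyclic_hermitianDual (pow_ne_zero m ha) (fun c hc => ?_) q
  obtain ⟨f, hf, rfl⟩ := mem_formCode.1 hc
  refine mem_formCode.2 ⟨_, comp_mem_linForms_pow hf (LinearMap.mulLeft F η), funext fun i => ?_⟩
  simp only [Function.comp_apply, LinearMap.mulLeft_apply, ← pow_succ']
  rcases (show (i : ℕ) + 1 ≤ n from i.isLt).lt_or_eq with hi | hi
  · have hval : ((i + 1 : Fin n) : ℕ) = i + 1 := Fin.val_add_one_of_lt' hi
    have hne : i + 1 ≠ 0 := fun h => Nat.succ_ne_zero i (hval.symm.trans (Fin.val_eq_zero_iff.2 h))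
    rw [if_neg hne, hval]
  · have hzero : i + 1 = 0 := Fin.ext (by simp [Fin.val_add, hi])
    rw [if_pos hzero, hzero, Fin.val_zero, pow_zero, hi, hη, Algebra.algebraMap_eq_smul_one,
      map_smul_of_mem_linForms_pow hf]

end Constacyclicity

section TraceAndNorm

variable {K F : Type*} [Field K] [Fintype K] [Field F] [Algebra K F]

lemma algebraMap_trace_eq_add_pow_card (hF : Module.finrank K F = 2) (z : F) :
    algebraMap K F (Algebra.trace K F z) = z + z ^ Fintype.card K := by
  have : Module.Finite K F := Module.finite_of_finrank_pos (by omega)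
  have : Finite F := Module.finite_of_finite K
  rw [FiniteField.algebraMap_trace_eq_sum_pow, hF, Finset.sum_range_succ, Finset.sum_range_one,
    pow_zero, pow_one, pow_one, Nat.card_eq_fintype_card]

lemma trace_pow_card_add_one (hF : Module.finrank K F = 2) (x : F) :
    Algebra.trace K F (x ^ (Fintype.card K + 1)) = 2 * Algebra.norm K x := by
  rw [← algebraMap_norm_eq_pow_card_add_one hF, Algebra.trace_algebraMap, hF, nsmul_eq_mul,
    Nat.cast_ofNat]

lemma trace_mul_pow_card_add_one_add (hF : Module.finrank K F = 2) (t y : F) :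
    Algebra.trace K F
        ((t * y) ^ (Fintype.card K + 1) + (t * y) ^ 2 * y ^ (Fintype.card K - 1)) =
      Algebra.norm K y * Algebra.trace K F t ^ 2 := by
  have hy : (t * y) ^ 2 * y ^ (Fintype.card K - 1) = algebraMap K F (Algebra.norm K y) * t ^ 2 := by
    rw [algebraMap_norm_eq_pow_card_add_one hF, mul_pow, mul_assoc, ← pow_add, mul_comm]
    congr 2
    have := Fintype.card_pos (α := K)
    omega
  rw [map_add, trace_pow_card_add_one hF, hy, ← Algebra.smul_def, map_smul, smul_eq_mul, map_mul]
  refine (algebraMap K F).injective ?_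
  simp only [map_add, map_mul, map_pow, map_ofNat, algebraMap_trace_eq_add_pow_card hF,
    algebraMap_norm_eq_pow_card_add_one hF]
  ring

lemma trace_pow_card_add_one_add_sub_norm_ne_zero (hF : Module.finrank K F = 2)
    (hK : ringChar K ≠ 2) {c : K} (hc : ¬IsSquare c) {x y : F} (hxy : x ≠ 0 ∨ y ≠ 0) :
    Algebra.trace K F (x ^ (Fintype.card K + 1) + x ^ 2 * y ^ (Fintype.card K - 1)) -
      c * Algebra.norm K y ≠ 0 := by
  have : Module.Finite K F := Module.finite_of_finrank_pos (by omega)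
  by_cases hy : y = 0
  · have hq : Fintype.card K - 1 ≠ 0 := (Nat.sub_pos_of_lt Fintype.one_lt_card).ne'
    rw [hy, zero_pow hq, mul_zero, add_zero, Algebra.norm_zero, mul_zero, sub_zero,
      trace_pow_card_add_one hF]
    exact mul_ne_zero (Ring.two_ne_zero hK)
      (Algebra.norm_ne_zero_iff.2 (hxy.resolve_right (not_not.2 hy)))
  · rw [← div_mul_cancel₀ x hy, trace_mul_pow_card_add_one_add hF, mul_comm c, ← mul_sub]
    refine mul_ne_zero (Algebra.norm_ne_zero_iff.2 hy) fun h => hc ?_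
    exact (sub_eq_zero.1 h) ▸ IsSquare.sq _

end TraceAndNorm

section PunctureWords

variable {ι K F E : Type*} [Fintype ι] [Field K] [Field F] [Algebra K F] [AddCommGroup E]
  [Module F E] {P : ι → E}

lemma mem_punctureCode_formCode {q m s : ℕ}
    (hP : ∀ w ∈ linForms F E ^ (m * q + m + s), ∑ i, w (P i) = 0) {v : E → F}
    (hv : v ∈ linForms F E ^ s) {x : ι → K} (hx : ∀ i, algebraMap K F (x i) = v (P i)) :
    x ∈ punctureCode K q (formCode F P m) := by
  rw [mem_punctureCode_iff]
  rintro _ ⟨f, hf, rfl⟩ _ ⟨g, hg, rfl⟩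
  rw [← hP _ (mul_mem_linForms_pow (mul_mem_linForms_pow (pow_mem_linForms_pow hf q) hg) hv)]
  refine Finset.sum_congr rfl fun i _ => ?_
  rw [hx, mul_comm]
  rfl

variable [Fintype K]

lemma trace_mem_punctureCode_formCode (hF : Module.finrank K F = 2) {m s : ℕ}
    (hP : ∀ w ∈ linForms F E ^ (m * Fintype.card K + m + s), ∑ i, w (P i) = 0) {v : E → F}
    (hv : v ∈ linForms F E ^ s) :
    (fun i => Algebra.trace K F (v (P i))) ∈ punctureCode K (Fintype.card K) (formCode F P m) := by
  rw [mem_punctureCode_iff]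
  rintro _ ⟨f, hf, rfl⟩ _ ⟨g, hg, rfl⟩
  have hfg := hP _ (mul_mem_linForms_pow (mul_mem_linForms_pow (pow_mem_linForms_pow hf _) hg) hv)
  have hgf := hP _ (mul_mem_linForms_pow (mul_mem_linForms_pow (pow_mem_linForms_pow hg _) hf) hv)
  calc ∑ i, algebraMap K F (Algebra.trace K F (v (P i))) *
        (f (P i) ^ Fintype.card K * g (P i))
      = ∑ i, f (P i) ^ Fintype.card K * g (P i) * v (P i) +
          (∑ i, g (P i) ^ Fintype.card K * f (P i) * v (P i)) ^ Fintype.card K := by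
        rw [sum_pow_card, ← Finset.sum_add_distrib]
        refine Finset.sum_congr rfl fun i _ => ?_
        rw [algebraMap_trace_eq_add_pow_card hF, mul_pow, mul_pow, pow_card_pow_card hF]
        ring
    _ = 0 := by
        rw [show ∑ i, f (P i) ^ Fintype.card K * g (P i) * v (P i) = 0 from hfg,
          show ∑ i, g (P i) ^ Fintype.card K * f (P i) * v (P i) = 0 from hgf,
          zero_pow Fintype.card_ne_zero, add_zero]

variable [Module.Finite F E]

lemma IsProjectiveSystem.sum_eq_zero_of_add_one_eq_sq (hF : Module.finrank K F = 2)
    (hE : 1 < Module.finrank F E) (hP : IsProjectiveSystem F P) {m : ℕ}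
    (hm : m + 1 = Fintype.card K ^ 2) {w : E → F} (hw : w ∈ linForms F E ^ m) :
    ∑ i, w (P i) = 0 := by
  have : Module.Finite K F := Module.finite_of_finrank_pos (by omega)
  have : Finite F := Module.finite_of_finite K
  have := Fintype.ofFinite F
  refine hP.sum_eq_zero hE ?_
  rwa [Module.card_eq_pow_finrank (K := K) (V := F), hF, ← hm, Nat.add_sub_cancel]

lemma IsProjectiveSystem.one_mem_punctureCode_formCode (hF : Module.finrank K F = 2)
    (hE : 1 < Module.finrank F E) (hP : IsProjectiveSystem F P) {m : ℕ}
    (hm : m + 1 = Fintype.card K) :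
    1 ∈ punctureCode K (Fintype.card K) (formCode F P m) :=
  mem_punctureCode_formCode (s := 0)
    (fun _ => hP.sum_eq_zero_of_add_one_eq_sq hF hE (by rw [← hm]; ring))
    (Submodule.one_le.1 (pow_zero (linForms F E)).ge) fun _ => map_one _

lemma IsProjectiveSystem.exists_mem_punctureCode_formCode_of_odd (hF : Module.finrank K F = 2)
    (hE : Module.finrank F E = 2) (hP : IsProjectiveSystem F P) {m : ℕ}
    (hm : m + 2 = Fintype.card K) (hK : Odd (Fintype.card K)) :
    ∃ x ∈ punctureCode K (Fintype.card K) (formCode F P m), ∀ i, x i ≠ 0 := by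
  have hchar : ringChar K ≠ 2 := fun h =>
    Nat.not_even_iff_odd.2 hK (Nat.even_iff.2 (FiniteField.even_card_iff_char_two.1 h))
  obtain ⟨c, hc⟩ := FiniteField.exists_nonsquare hchar
  let b := Module.finBasisOfFinrankEq F E hE
  have hcoord (j : Fin 2) (n : ℕ) : (b.coord j : E → F) ^ n ∈ linForms F E ^ n :=
    Submodule.pow_mem_pow _ (coe_mem_linForms _) n
  have hsum (w) (hw : w ∈ linForms F E ^ (m * Fintype.card K + m + (Fintype.card K + 1))) :
      ∑ i, w (P i) = 0 :=
    hP.sum_eq_zero_of_add_one_eq_sq hF (hE ▸ one_lt_two) (by rw [← hm]; ring) hw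
  have hXY : (b.coord 0 : E → F) ^ 2 * (b.coord 1 : E → F) ^ (Fintype.card K - 1) ∈
      linForms F E ^ (Fintype.card K + 1) := by
    have h := mul_mem_linForms_pow (hcoord 0 2) (hcoord 1 (Fintype.card K - 1))
    rwa [show 2 + (Fintype.card K - 1) = Fintype.card K + 1 by omega] at h
  -- the word of the values of `Tr(X ^ (q + 1) + X ^ 2 * Y ^ (q - 1)) - c * N(Y)`
  refine ⟨_, sub_mem (trace_mem_punctureCode_formCode hF hsum (add_mem (hcoord 0 _) hXY))
    (Submodule.smul_mem _ c (mem_punctureCode_formCode hsum (hcoord 1 _) fun i =>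
      algebraMap_norm_eq_pow_card_add_one hF (b.coord 1 (P i)))), fun i => ?_⟩
  refine trace_pow_card_add_one_add_sub_norm_ne_zero hF hchar hc ?_
  by_contra! h
  exact hP.ne_zero i (b.ext_elem (Fin.forall_fin_two.2 ⟨by simpa using h.1, by simpa using h.2⟩))

end PunctureWords

section NormMultiples

variable {ι K F E : Type*} [Fintype ι] [Field K] [Fintype K] [Field F] [Algebra K F] [Field E]
  [Algebra F E] [Module.Finite F E] {P : ι → E}

lemma norm_pow_mul_mem_punctureCode_formCode (hF : Module.finrank K F = 2) {m j : ℕ} {x : ι → K}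
    (hx : x ∈ punctureCode K (Fintype.card K) (formCode F P (m + Module.finrank F E * j))) :
    (fun i => Algebra.norm K (Algebra.norm F (P i)) ^ j * x i) ∈
      punctureCode K (Fintype.card K) (formCode F P m) := by
  have hN := pow_mem_linForms_pow (norm_mem_linForms_pow F E) j
  rw [mem_punctureCode_iff] at hx ⊢
  rintro _ ⟨f, hf, rfl⟩ _ ⟨g, hg, rfl⟩
  rw [← hx _ (mem_formCode.2 ⟨_, mul_mem_linForms_pow hf hN, rfl⟩) _
    (mem_formCode.2 ⟨_, mul_mem_linForms_pow hg hN, rfl⟩)]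
  refine Finset.sum_congr rfl fun i _ => ?_
  simp only [LinearMap.funLeft_apply, Function.comp_apply, Pi.mul_apply, Pi.pow_apply, map_mul,
    map_pow, algebraMap_norm_eq_pow_card_add_one hF]
  ring

theorem IsProjectiveSystem.exists_mem_punctureCode_formCode (hF : Module.finrank K F = 2)
    (hE : Module.finrank F E = 2) (hP : IsProjectiveSystem F P) {m : ℕ} (hm : m < Fintype.card K)
    (hpar : Odd (Fintype.card K) ∨ Odd m) :
    ∃ x ∈ punctureCode K (Fintype.card K) (formCode F P m), ∀ i, x i ≠ 0 := by
  obtain ⟨j, hj⟩ : ∃ j, ∃ x ∈ punctureCode K (Fintype.card K) (formCode F P (m + 2 * j)),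
      ∀ i, x i ≠ 0 := by
    rcases Nat.even_or_odd' (Fintype.card K - 1 - m) with ⟨j, hj | hj⟩
    · exact ⟨j, 1, hP.one_mem_punctureCode_formCode hF (hE ▸ one_lt_two) (by omega),
        fun _ => one_ne_zero⟩
    · refine ⟨j, hP.exists_mem_punctureCode_formCode_of_odd hF hE (by omega) ?_⟩
      exact hpar.elim id fun h => by rw [Nat.odd_iff] at h ⊢; omega
  obtain ⟨x, hx, hx0⟩ := hj
  have : Module.Finite K F := Module.finite_of_finrank_pos (by omega)
  refine ⟨_, norm_pow_mul_mem_punctureCode_formCode hF (hE.symm ▸ hx), fun i => ?_⟩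
  exact mul_ne_zero (pow_ne_zero _ (Algebra.norm_ne_zero_iff.2
    (Algebra.norm_ne_zero_iff.2 (hP.ne_zero i)))) (hx0 i)

end NormMultiples

lemma exists_isConstacyclic_hermitianDual_and_hasStrength {K F : Type*} [Field K] [Fintype K]
    [Field F] [Algebra K F] (hF : Module.finrank K F = 2) {k : ℕ} (hk : k ≤ Fintype.card K)
    (hpar : Odd (Fintype.card K) ∨ Odd (k + 1)) :
    ∃ C : Submodule F (Fin (Fintype.card K ^ 2 + 1) → F),
      IsConstacyclic (hermitianDual (Fintype.card K) C) ∧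
      HasStrength C k ∧ Module.finrank F C ≤ k ∧
      ∃ x ∈ punctureCode K (Fintype.card K) C, ∀ i, x i ≠ 0 := by
  rcases k with _ | m
  · refine ⟨⊥, isConstacyclic_hermitianDual one_ne_zero (fun c hc => ?_) _, fun T hT _ => ?_,
      (finrank_bot F _).le, 1, mem_punctureCode_iff.2 fun c _ c' hc' => ?_, fun _ => one_ne_zero⟩
    · simp [(Submodule.mem_bot F).1 hc, funext_iff]
    · exact ⟨0, zero_mem _, by simp [Finset.card_eq_zero.1 hT]⟩
    · simp [(Submodule.mem_bot F).1 hc']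
  have : Module.Finite K F := Module.finite_of_finrank_pos (by omega)
  have : Finite F := Module.finite_of_finite K
  have := Fintype.ofFinite F
  have hcard : Fintype.card K ^ 2 + 1 = Fintype.card F + 1 := by
    rw [Module.card_eq_pow_finrank (K := K) (V := F), hF]
  obtain ⟨p, hp⟩ := CharP.exists F
  have : Fact p.Prime := ⟨CharP.char_is_prime F p⟩
  let E := FiniteField.Extension F p 2
  have hE : Module.finrank F E = 2 := FiniteField.finrank_extension F p 2
  have : Module.Finite F E := Module.finite_of_finrank_pos (by omega)
  obtain ⟨η, hη⟩ := IsCyclic.exists_generator (α := Eˣ)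
  have hP := isProjectiveSystem_pow hE hη hcard
  have hnorm : (η : E) ^ (Fintype.card K ^ 2 + 1) = algebraMap F E (Algebra.norm F (η : E)) := by
    rw [hcard, algebraMap_norm_eq_pow_card_add_one hE]
  refine ⟨_, isConstacyclic_hermitianDual_formCode (Algebra.norm_ne_zero_iff.2 η.ne_zero) hnorm m _,
    hasStrength_formCode hP.notMem_span_singleton m,
    (finrank_formCode_le _ m).trans (by rw [hE, Nat.multichoose_two]),
    hP.exists_mem_punctureCode_formCode hF hE hk (hpar.imp_right fun h => ?_)⟩
  rw [Nat.odd_iff] at h ⊢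
  omega

theorem mainTheorem1 {K F : Type*} [Field K] [Fintype K] [DecidableEq K]
    [Field F] [DecidableEq F] [Algebra K F]
    (e : F ≃ₗ[K] K × K) (χ : AddChar K ℂ) (hχ : χ ≠ 1)
    (q d : ℕ) (hq : Fintype.card K = q) (hd1 : 1 ≤ d) (hdq : d ≤ q + 1)
    (hpar : Odd q ∨ (Even q ∧ Odd d)) :
    ∃ C : Submodule F (Fin (q ^ 2 + 1) → F),
      IsConstacyclic (hermitianDual q C) ∧
      IsMDSCode (hermitianDual q C) (q ^ 2 + 2 - d) d ∧
      ∃ x ∈ punctureCode K q C, hammingNorm x = q ^ 2 + 1 ∧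
      ∃ y : Fin (q ^ 2 + 1) → F, (∀ i, y i ^ (q + 1) = algebraMap K F (x i)) ∧
      rescale y C ≤ hermitianDual q (rescale y C) ∧
      ∃ Q : Submodule ℂ ((Fin (q ^ 2 + 1) → K) → ℂ),
        IsStabilizerCodeOf χ e (rescale y C) Q ∧
        IsQuantumMDSCode Q (q ^ 2 + 3 - 2 * d) d := by
  subst hq
  obtain ⟨k, rfl⟩ := Nat.exists_eq_add_of_le' hd1
  have hF := finrank_eq_two_of_linearEquiv e
  have hk : k ≤ Fintype.card K := Nat.le_of_succ_le_succ hdq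
  have hkn : 2 * k < Fintype.card (Fin (Fintype.card K ^ 2 + 1)) := by
    rw [Fintype.card_fin, Nat.lt_succ_iff, sq]
    exact Nat.mul_le_mul Fintype.one_lt_card hk
  obtain ⟨C, hshift, hC, hCk, x, hx, hx0⟩ :=
    exists_isConstacyclic_hermitianDual_and_hasStrength hF hk (hpar.imp_right And.right)
  have hmds := hC.isMDSCode_hermitianDual K (by omega) hCk
  have hquantum := hC.exists_isQuantumMDSCode_rescale hχ e hCk hkn hx hx0
  rw [Fintype.card_fin] at hmds hquantum
  rw [show Fintype.card K ^ 2 + 2 - (k + 1) = Fintype.card K ^ 2 + 1 - k by omega,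
    show Fintype.card K ^ 2 + 3 - 2 * (k + 1) = Fintype.card K ^ 2 + 1 - 2 * k by omega]
  exact ⟨C, hshift, hmds, x, hx, by simp [hammingNorm, hx0], hquantum⟩
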